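/- **Theorem (completeness of fD.LG with respect to fully polarized LG-algebras).** If a well-formed sequent $\Psi\ t\ \Phi$ is true under every interpretation in every fully polarized LG-algebra, and if its standard sequent $\mathsf{Ftom}(\Psi)\ t\ \mathsf{FtoM}(\Phi)$ is defined, then this standard sequent is derivable in fD.LG. The notions are as follows. **Language.** Fix disjoint sets of positive letters $p$ and negative letters $n$ (denumerable, or of any cardinality). There are four sorts of formulas: pure positive $P$, shifted positive $\dot P$, pure negative $N$, shifted negative $\dot N$; a ring means "pure or shifted" ($\mathring P\in\{P,\dot P\}$ etc.): $$P::=p\mid \mathring P\otimes\mathring P\mid\mathring P\oslash\mathring N\mid\mathring N\ominus\mathring P,\qquad N::=n\mid\mathring N\oplus\mathring N\mid\mathring P\backslash\mathring N\mid\mathring N/\mathring P,\qquad \dot P::=\downarrow N,\qquad \dot N::=\uparrow P.$$ Structures (positive $X$, $\dot X$; negative $\Delta$, $\dot\Delta$) are built from formulas of the same sort by structural connectives (written here like the formula connectives): $$X::=P\mid\ \downharpoonright\!\dot\Delta\mid\mathring X\otimes\mathring X\mid\mathring X\oslash\mathring\Delta\mid\mathring\Delta\ominus\mathring X,\qquad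 \Delta::=N\mid\ \upharpoonleft\!\dot X\mid\mathring\Delta\oplus\mathring\Delta\mid\mathring X\backslash\mathring\Delta\mid\mathring\Delta/\mathring X,$$ $$\dot X::=\dot P\mid\ \downarrow\Delta\mid\mathring X\oplus_\ell\mathring\Delta\mid\mathring\Delta\oplus_r\mathring X\mid\mathring\Delta\backslash_\ell\mathring\Delta\mid\mathring X\backslash_r\mathring X\mid\mathring X/_\ell\mathring X\mid\mathring\Delta/_r\mathring\Delta,$$ $$\dot\Delta::=\dot N\mid\ \uparrow X\mid\mathring\Delta\otimes_\ell\mathring X\mid\mathring X\otimes_r\mathring\Delta\mid\mathring\Delta\oslash_\ell\mathring\Delta\mid\mathring X\oslash_r\mathring X\mid\mathring X\ominus_\ell\mathring X\mid\mathring\Delta\ominus_r\mathring\Delta.$$ The well-formed sequents are the positive ones $\mathring X\vdash^+\mathring Y$, the negative ones $\mathring\Delta\vdash^-\mathring\Gamma$ and the neutral ones $\mathring X\vdash^0\mathring\Delta$ (twelve turnstiles $t$, determined by the sorts of the two sides). **The calculus fD.LG.** In the rules $\mathring P,\mathring Q,\mathring N,\mathring M$ stand for formulas and the other letters for structures. *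 Axioms: $p\vdash^+p$ and $n\vdash^-n$. * Cuts: from $\mathring X\vdash^+\mathring P$ and $\mathring P\vdash^+\mathring Y$ infer $\mathring X\vdash^+\mathring Y$; from $\mathring\Gamma\vdash^-\mathring N$ and $\mathring N\vdash^-\mathring\Delta$ infer $\mathring\Gamma\vdash^-\mathring\Delta$; from $\mathring X\vdash^+\mathring P$ and $\mathring P\vdash^0\mathring\Delta$ infer $\mathring X\vdash^0\mathring\Delta$; from $\mathring X\vdash^0\mathring N$ and $\mathring N\vdash^-\mathring\Delta$ infer $\mathring X\vdash^0\mathring\Delta$. * Translation rules: in a neutral sequent, a left-hand side which is the structure $\mathring P\otimes\mathring Q$, $\mathring P\oslash\mathring N$ or $\mathring N\ominus\mathring P$ with formulas as arguments may be replaced by the corresponding formula, and likewise a right-hand side $\mathring N\oplus\mathring M$, $\mathring P\backslash\mathring N$ or $\mathring N/\mathring P$; the same for a right-hand side $\downarrow N$ of a positive sequent and a left-hand side $\uparrow P$ of a negative sequent. * Tonicity rules, with premises chosen among $\mathring X\vdash^+\mathring P$, $\mathring Y\vdash^+\mathring Q$, $\mathring N\vdash^-\mathring\Gamma$, $\mathring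 M\vdash^-\mathring\Delta$ for the components that occur, and with a structural connective on one side and the corresponding formula on the other: $\mathring X\otimes\mathring Y\vdash^+\mathring P\otimes\mathring Q$; $\mathring X\oslash\mathring\Gamma\vdash^+\mathring P\oslash\mathring N$; $\mathring\Gamma\ominus\mathring X\vdash^+\mathring N\ominus\mathring P$; $\mathring N\oplus\mathring M\vdash^-\mathring\Gamma\oplus\mathring\Delta$; $\mathring P\backslash\mathring N\vdash^-\mathring X\backslash\mathring\Gamma$; $\mathring N/\mathring P\vdash^-\mathring\Gamma/\mathring X$; moreover from $N\vdash^-\Delta$ infer $\downarrow N\vdash^+\downarrow\Delta$ and from $X\vdash^+P$ infer $\uparrow X\vdash^-\uparrow P$. * Invertible rules: within each of the following groups, each sequent may be inferred from each of the others: 1. $\mathring Y\vdash^0\mathring X\backslash\mathring\Delta$; $\ \mathring X\otimes\mathring Y\vdash^0\mathring\Delta$; $\ \mathring X\vdash^0\mathring\Delta/\mathring Y$. 2. $\mathring X\oslash\mathring\Delta\vdash^0\mathring\Gamma$; $\ \mathring X\vdash^0\mathring\Gamma\oplus\mathring\Delta$; $\ \mathring\Gamma\ominus\mathring X\vdash^0\mathring\Delta$.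 3. $\mathring Y\vdash^+\mathring X\backslash_r\mathring Z$; $\ \mathring X\otimes\mathring Y\vdash^+\mathring Z$; $\ \mathring X\vdash^+\mathring Z/_\ell\mathring Y$. 4. $\mathring\Sigma\oslash_\ell\mathring\Delta\vdash^-\mathring\Gamma$; $\ \mathring\Sigma\vdash^-\mathring\Gamma\oplus\mathring\Delta$; $\ \mathring\Gamma\ominus_r\mathring\Sigma\vdash^-\mathring\Delta$. 5. $\mathring\Gamma\ominus\mathring X\vdash^+\mathring Y$; $\ \mathring X\vdash^+\mathring\Gamma\oplus_r\mathring Y$; $\ \mathring X\oslash_r\mathring Y\vdash^-\mathring\Gamma$. 6. $\mathring X\oslash\mathring\Delta\vdash^+\mathring Y$; $\ \mathring X\vdash^+\mathring Y\oplus_\ell\mathring\Delta$; $\ \mathring Y\ominus_\ell\mathring X\vdash^-\mathring\Delta$. 7. $\mathring\Gamma\vdash^-\mathring X\backslash\mathring\Delta$; $\ \mathring X\otimes_r\mathring\Gamma\vdash^-\mathring\Delta$; $\ \mathring X\vdash^+\mathring\Delta/_r\mathring\Gamma$. 8. $\mathring Y\vdash^+\mathring\Gamma\backslash_\ell\mathring\Delta$;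 $\ \mathring\Gamma\otimes_\ell\mathring Y\vdash^-\mathring\Delta$; $\ \mathring\Gamma\vdash^-\mathring\Delta/\mathring Y$. 9. $\uparrow X\vdash^-\dot\Delta$; $\ X\vdash^+\downharpoonright\!\dot\Delta$. 10. $\uparrow X\vdash^-\Delta$; $\ X\vdash^+\downarrow\Delta$. 11. $\dot X\vdash^+\downarrow\Delta$; $\ \upharpoonleft\!\dot X\vdash^-\Delta$. 12. $\mathring X\vdash^0\Delta$; $\ \mathring X\vdash^+\downarrow\Delta$. 13. $X\vdash^0\mathring\Delta$; $\ \uparrow X\vdash^-\mathring\Delta$. **Standard sequents.** Let $\mathcal F$ consist of $\otimes,\oslash,\ominus$, their $\ell,r$-variants, $\uparrow,\upharpoonleft$ and $\mathcal G$ of $\oplus,\backslash,/$, their variants, $\downarrow,\downharpoonright$. In the signed generation tree $+\Psi$ (resp. $-\Psi$) the root has sign $+$ (resp. $-$), and signs are inherited by children, except that they are reversed at the first argument of $\ominus,\backslash$ and their variants and at the second argument of $\oslash,/$ and their variants. A node is skeleton if it is $+f$ with $f\in\mathcal F$ or $-g$ with $g\in\mathcal G$, and PIA otherwise. The principal subtree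 is the largest subtree containing the root and consisting only of skeleton nodes or only of PIA nodes. $\mathsf{Ftom}(\Psi)$ (resp. $\mathsf{FtoM}(\Psi)$) is obtained from $\Psi$, connectives of formulas included, by making the connectives of the principal subtree of $+\Psi$ (resp. $-\Psi$) structural if it is skeleton and operational if it is PIA, and making all other connectives operational; it is undefined if a variant, $\upharpoonleft$ or $\downharpoonright$ (which have no operational counterpart) would have to be made operational. **Algebras.** A weakening relation between posets $A,B$ is a relation $R\subseteq A\times B$ such that $a'\le a$, $aRb$, $b\le b'$ imply $a'Rb'$. A fully polarized LG-algebra consists of four posets $\mathbb P,\dot{\mathbb P},\mathbb N,\dot{\mathbb N}$; maps $\uparrow:\mathbb P\to\dot{\mathbb N}$, $\downharpoonright:\dot{\mathbb N}\to\mathbb P$, $\upharpoonleft:\dot{\mathbb P}\to\mathbb N$, $\downarrow:\mathbb N\to\dot{\mathbb P}$ with adjunctions $\uparrow\dashv\downharpoonright$ and $\upharpoonleft\dashv\downarrow$; weakening relations $R_+\subseteq\mathbb P\times\dot{\mathbb P}$, $R_0\subseteq\mathbb P\times\mathbb N$, $R_-\subseteq\dot{\mathbb N}\times\mathbb N$ with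 $\uparrow x\,R_-\,y\iff x\,R_0\,y\iff x\,R_+\downarrow y$; and operations as described next. Let $\mathring{\mathbb P}=\mathbb P\sqcup\dot{\mathbb P}$ be ordered by $\le_+$, the union of the two orders and $R_+$; let $\mathring{\mathbb N}=\mathbb N\sqcup\dot{\mathbb N}$ be ordered by $\le_-$, the union of the two orders and $R_-$; and let $\preceq\ \subseteq\mathring{\mathbb P}\times\mathring{\mathbb N}$ be $R_0$ on $\mathbb P\times\mathbb N$, $\uparrow x\le y$ on $\mathbb P\times\dot{\mathbb N}$, $\upharpoonleft x\le y$ on $\dot{\mathbb P}\times\mathbb N$, and empty on $\dot{\mathbb P}\times\dot{\mathbb N}$. For each of the six connectives and twelve variants there is an operation with arguments in $\mathring{\mathbb P}$ or $\mathring{\mathbb N}$ and values in one of the four posets, with the sorts given by the grammar of structures. Each operation is order-reversing in the arguments at which signs are reversed and order-preserving in the others. For all values of the variables, the statements in each of the groups 1–8 above must be equivalent to each other, where $\vdash^+,\vdash^-,\vdash^0$ are read as $\le_+,\le_-,\preceq$. **Truth.** An interpretation sends positive letters to elements of $\mathbb P$ and negative letters to elements of $\mathbb N$, and is extended homomorphically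 to formulas and structures (structural and operational connectives are interpreted alike). A sequent is true under it if the interpretations of its two sides are related by $\le_+$, $\le_-$ or $\preceq$, according to whether it is positive, negative or neutral. -/

import Mathlib

universe u

namespace FDLG

/-! ## Sorts, formulas, structures -/

inductive Polarity
  | pos
  | neg

inductive Kind
  | pure
  | shifted

/-- Operational formulas over the positive letters `α` and the negative letters `β`. `Fm α β p k`
is the set of formulas of polarity `p` which are pure or shifted according to `k`. The implicit
kinds `i`, `j` of the arguments range freely over `pure` and `shifted`: the arguments are general
formulas. -/
inductive Fm (α β : Type u) : Polarity → Kind → Type u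
  /-- positive letters -/
  | posAtom (a : α) : Fm α β .pos .pure
  /-- negative letters -/
  | negAtom (b : β) : Fm α β .neg .pure
  /-- `P ⊗ Q` -/
  | tensor {i j : Kind} (A : Fm α β .pos i) (B : Fm α β .pos j) : Fm α β .pos .pure
  /-- `P ⊘ N` -/
  | oslash {i j : Kind} (A : Fm α β .pos i) (B : Fm α β .neg j) : Fm α β .pos .pure
  /-- `N ⦸ P` -/
  | obslash {i j : Kind} (A : Fm α β .neg i) (B : Fm α β .pos j) : Fm α β .pos .pure
  /-- `N ⊕ M` -/
  | oplus {i j : Kind} (A : Fm α β .neg i) (B : Fm α β .neg j) : Fm α β .neg .pure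
  /-- `P \ N` -/
  | bslash {i j : Kind} (A : Fm α β .pos i) (B : Fm α β .neg j) : Fm α β .neg .pure
  /-- `N / P` -/
  | slash {i j : Kind} (A : Fm α β .neg i) (B : Fm α β .pos j) : Fm α β .neg .pure
  /-- `↓ N` -/
  | down (A : Fm α β .neg .pure) : Fm α β .pos .shifted
  /-- `↑ P` -/
  | up (A : Fm α β .pos .pure) : Fm α β .neg .shifted

/-- Structures: built from formulas by the structural counterparts of the connectives, of their
`ℓ`- and `r`-variants, and of the shifts and their adjoints. -/
inductive Str (α β : Type u) : Polarity → Kind → Type u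
  /-- a formula, seen as a structure -/
  | fm {p : Polarity} {k : Kind} (A : Fm α β p k) : Str α β p k
  /-- structural `P ⊗ Q` -/
  | tensor {i j : Kind} (X : Str α β .pos i) (Y : Str α β .pos j) : Str α β .pos .pure
  /-- structural `P ⊘ N` -/
  | oslash {i j : Kind} (X : Str α β .pos i) (Y : Str α β .neg j) : Str α β .pos .pure
  /-- structural `N ⦸ P` -/
  | obslash {i j : Kind} (X : Str α β .neg i) (Y : Str α β .pos j) : Str α β .pos .pure
  /-- structural `N ⊕ M` -/
  | oplus {i j : Kind} (X : Str α β .neg i) (Y : Str α β .neg j) : Str α β .neg .pure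
  /-- structural `P \ N` -/
  | bslash {i j : Kind} (X : Str α β .pos i) (Y : Str α β .neg j) : Str α β .neg .pure
  /-- structural `N / P` -/
  | slash {i j : Kind} (X : Str α β .neg i) (Y : Str α β .pos j) : Str α β .neg .pure
  /-- structural `⊗_ℓ` -/
  | tensorL {i j : Kind} (X : Str α β .neg i) (Y : Str α β .pos j) : Str α β .neg .shifted
  /-- structural `⊗_r` -/
  | tensorR {i j : Kind} (X : Str α β .pos i) (Y : Str α β .neg j) : Str α β .neg .shifted
  /-- structural `⊘_ℓ` -/
  | oslashL {i j : Kind} (X : Str α β .neg i) (Y : Str α β .neg j) : Str α β .neg .shifted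
  /-- structural `⊘_r` -/
  | oslashR {i j : Kind} (X : Str α β .pos i) (Y : Str α β .pos j) : Str α β .neg .shifted
  /-- structural `⦸_ℓ` -/
  | obslashL {i j : Kind} (X : Str α β .pos i) (Y : Str α β .pos j) : Str α β .neg .shifted
  /-- structural `⦸_r` -/
  | obslashR {i j : Kind} (X : Str α β .neg i) (Y : Str α β .neg j) : Str α β .neg .shifted
  /-- structural `⊕_ℓ` -/
  | oplusL {i j : Kind} (X : Str α β .pos i) (Y : Str α β .neg j) : Str α β .pos .shifted
  /-- structural `⊕_r` -/
  | oplusR {i j : Kind} (X : Str α β .neg i) (Y : Str α β .pos j) : Str α β .pos .shifted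
  /-- structural `\_ℓ` -/
  | bslashL {i j : Kind} (X : Str α β .neg i) (Y : Str α β .neg j) : Str α β .pos .shifted
  /-- structural `\_r` -/
  | bslashR {i j : Kind} (X : Str α β .pos i) (Y : Str α β .pos j) : Str α β .pos .shifted
  /-- structural `/_ℓ` -/
  | slashL {i j : Kind} (X : Str α β .pos i) (Y : Str α β .pos j) : Str α β .pos .shifted
  /-- structural `/_r` -/
  | slashR {i j : Kind} (X : Str α β .neg i) (Y : Str α β .neg j) : Str α β .pos .shifted
  /-- structural `↓` -/
  | down (X : Str α β .neg .pure) : Str α β .pos .shifted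
  /-- structural `⇂`, the right adjoint of `↑` -/
  | downHarp (X : Str α β .neg .shifted) : Str α β .pos .pure
  /-- structural `↑` -/
  | up (X : Str α β .pos .pure) : Str α β .neg .shifted
  /-- structural `↿`, the left adjoint of `↓` -/
  | upHarp (X : Str α β .pos .shifted) : Str α β .neg .pure

/-- Well-formed sequents: positive, negative and neutral ones. The turnstile is determined by the
polarities and kinds of the two sides, so each constructor stands for four turnstiles. -/
inductive Sequent (α β : Type u) : Type u
  | pos {i j : Kind} (X : Str α β .pos i) (Y : Str α β .pos j) : Sequent α β
  | neg {i j : Kind} (X : Str α β .neg i) (Y : Str α β .neg j) : Sequent α β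
  | neutral {i j : Kind} (X : Str α β .pos i) (Y : Str α β .neg j) : Sequent α β

scoped infix:45 " ⊢⁺ " => Sequent.pos
scoped infix:45 " ⊢⁻ " => Sequent.neg
scoped infix:45 " ⊢⁰ " => Sequent.neutral

/-! ## The calculus fD.LG -/

open Str in
/-- Derivability in fD.LG. The turnstile of each premise and conclusion is determined by the sorts
of its two sides. An invertible rule is split into its two directions `_fwd` and `_bwd`. -/
inductive Derivable {α β : Type u} : Sequent α β → Prop
  -- axioms
  | posId (a : α) : Derivable (fm (.posAtom a) ⊢⁺ fm (.posAtom a))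
  | negId (b : β) : Derivable (fm (.negAtom b) ⊢⁻ fm (.negAtom b))
  -- cuts
  | posCut {i j k : Kind} (X : Str α β .pos i) (P : Fm α β .pos j) (Y : Str α β .pos k) :
      Derivable (X ⊢⁺ fm P) → Derivable (fm P ⊢⁺ Y) → Derivable (X ⊢⁺ Y)
  | negCut {i j k : Kind} (G : Str α β .neg i) (N : Fm α β .neg j) (D : Str α β .neg k) :
      Derivable (G ⊢⁻ fm N) → Derivable (fm N ⊢⁻ D) → Derivable (G ⊢⁻ D)
  | posNeutralCut {i j k : Kind} (X : Str α β .pos i) (P : Fm α β .pos j) (D : Str α β .neg k) :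
      Derivable (X ⊢⁺ fm P) → Derivable (fm P ⊢⁰ D) → Derivable (X ⊢⁰ D)
  | neutralNegCut {i j k : Kind} (X : Str α β .pos i) (N : Fm α β .neg j) (D : Str α β .neg k) :
      Derivable (X ⊢⁰ fm N) → Derivable (fm N ⊢⁻ D) → Derivable (X ⊢⁰ D)
  -- logical rules
  | tensor_left {i j k : Kind} (P : Fm α β .pos i) (Q : Fm α β .pos j) (D : Str α β .neg k) :
      Derivable (tensor (fm P) (fm Q) ⊢⁰ D) → Derivable (fm (.tensor P Q) ⊢⁰ D)
  | tensor_right {i j k l : Kind}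
      (X : Str α β .pos i) (P : Fm α β .pos j) (Y : Str α β .pos k) (Q : Fm α β .pos l) :
      Derivable (X ⊢⁺ fm P) → Derivable (Y ⊢⁺ fm Q) → Derivable (tensor X Y ⊢⁺ fm (.tensor P Q))
  | oplus_left {i j k l : Kind}
      (N : Fm α β .neg i) (G : Str α β .neg j) (M : Fm α β .neg k) (D : Str α β .neg l) :
      Derivable (fm N ⊢⁻ G) → Derivable (fm M ⊢⁻ D) → Derivable (fm (.oplus N M) ⊢⁻ oplus G D)
  | oplus_right {i j k : Kind} (X : Str α β .pos i) (N : Fm α β .neg j) (M : Fm α β .neg k) :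
      Derivable (X ⊢⁰ oplus (fm N) (fm M)) → Derivable (X ⊢⁰ fm (.oplus N M))
  | oslash_left {i j k : Kind} (P : Fm α β .pos i) (N : Fm α β .neg j) (D : Str α β .neg k) :
      Derivable (oslash (fm P) (fm N) ⊢⁰ D) → Derivable (fm (.oslash P N) ⊢⁰ D)
  | oslash_right {i j k l : Kind}
      (X : Str α β .pos i) (P : Fm α β .pos j) (N : Fm α β .neg k) (D : Str α β .neg l) :
      Derivable (X ⊢⁺ fm P) → Derivable (fm N ⊢⁻ D) → Derivable (oslash X D ⊢⁺ fm (.oslash P N))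
  | bslash_left {i j k l : Kind}
      (X : Str α β .pos i) (P : Fm α β .pos j) (N : Fm α β .neg k) (D : Str α β .neg l) :
      Derivable (X ⊢⁺ fm P) → Derivable (fm N ⊢⁻ D) → Derivable (fm (.bslash P N) ⊢⁻ bslash X D)
  | bslash_right {i j k : Kind} (X : Str α β .pos i) (P : Fm α β .pos j) (N : Fm α β .neg k) :
      Derivable (X ⊢⁰ bslash (fm P) (fm N)) → Derivable (X ⊢⁰ fm (.bslash P N))
  | obslash_left {i j k : Kind} (N : Fm α β .neg i) (P : Fm α β .pos j) (D : Str α β .neg k) :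
      Derivable (obslash (fm N) (fm P) ⊢⁰ D) → Derivable (fm (.obslash N P) ⊢⁰ D)
  | obslash_right {i j k l : Kind}
      (N : Fm α β .neg i) (D : Str α β .neg j) (X : Str α β .pos k) (P : Fm α β .pos l) :
      Derivable (fm N ⊢⁻ D) → Derivable (X ⊢⁺ fm P) → Derivable (obslash D X ⊢⁺ fm (.obslash N P))
  | slash_left {i j k l : Kind}
      (N : Fm α β .neg i) (D : Str α β .neg j) (X : Str α β .pos k) (P : Fm α β .pos l) :
      Derivable (fm N ⊢⁻ D) → Derivable (X ⊢⁺ fm P) → Derivable (fm (.slash N P) ⊢⁻ slash D X)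
  | slash_right {i j k : Kind} (X : Str α β .pos i) (N : Fm α β .neg j) (P : Fm α β .pos k) :
      Derivable (X ⊢⁰ slash (fm N) (fm P)) → Derivable (X ⊢⁰ fm (.slash N P))
  | down_left (N : Fm α β .neg .pure) (D : Str α β .neg .pure) :
      Derivable (fm N ⊢⁻ D) → Derivable (fm (.down N) ⊢⁺ down D)
  | down_right {i : Kind} (X : Str α β .pos i) (N : Fm α β .neg .pure) :
      Derivable (X ⊢⁺ down (fm N)) → Derivable (X ⊢⁺ fm (.down N))
  | up_left {i : Kind} (P : Fm α β .pos .pure) (D : Str α β .neg i) :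
      Derivable (up (fm P) ⊢⁻ D) → Derivable (fm (.up P) ⊢⁻ D)
  | up_right (X : Str α β .pos .pure) (P : Fm α β .pos .pure) :
      Derivable (X ⊢⁺ fm P) → Derivable (up X ⊢⁻ fm (.up P))
  -- display postulates
  | tensor_bslash_fwd {i j k : Kind}
      (Y : Str α β .pos i) (X : Str α β .pos j) (D : Str α β .neg k) :
      Derivable (Y ⊢⁰ bslash X D) → Derivable (tensor X Y ⊢⁰ D)
  | tensor_bslash_bwd {i j k : Kind}
      (X : Str α β .pos i) (Y : Str α β .pos j) (D : Str α β .neg k) :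
      Derivable (tensor X Y ⊢⁰ D) → Derivable (Y ⊢⁰ bslash X D)
  | tensor_slash_fwd {i j k : Kind} (X : Str α β .pos i) (Y : Str α β .pos j) (D : Str α β .neg k) :
      Derivable (tensor X Y ⊢⁰ D) → Derivable (X ⊢⁰ slash D Y)
  | tensor_slash_bwd {i j k : Kind} (X : Str α β .pos i) (D : Str α β .neg j) (Y : Str α β .pos k) :
      Derivable (X ⊢⁰ slash D Y) → Derivable (tensor X Y ⊢⁰ D)
  | tensor_bslashR_fwd {i j k : Kind}
      (Y : Str α β .pos i) (X : Str α β .pos j) (Z : Str α β .pos k) :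
      Derivable (Y ⊢⁺ bslashR X Z) → Derivable (tensor X Y ⊢⁺ Z)
  | tensor_bslashR_bwd {i j k : Kind}
      (X : Str α β .pos i) (Y : Str α β .pos j) (Z : Str α β .pos k) :
      Derivable (tensor X Y ⊢⁺ Z) → Derivable (Y ⊢⁺ bslashR X Z)
  | tensor_slashL_fwd {i j k : Kind}
      (X : Str α β .pos i) (Y : Str α β .pos j) (Z : Str α β .pos k) :
      Derivable (tensor X Y ⊢⁺ Z) → Derivable (X ⊢⁺ slashL Z Y)
  | tensor_slashL_bwd {i j k : Kind}
      (X : Str α β .pos i) (Z : Str α β .pos j) (Y : Str α β .pos k) :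
      Derivable (X ⊢⁺ slashL Z Y) → Derivable (tensor X Y ⊢⁺ Z)
  | oslashL_oplus_fwd {i j k : Kind}
      (S : Str α β .neg i) (D : Str α β .neg j) (G : Str α β .neg k) :
      Derivable (oslashL S D ⊢⁻ G) → Derivable (S ⊢⁻ oplus G D)
  | oslashL_oplus_bwd {i j k : Kind}
      (S : Str α β .neg i) (G : Str α β .neg j) (D : Str α β .neg k) :
      Derivable (S ⊢⁻ oplus G D) → Derivable (oslashL S D ⊢⁻ G)
  | obslashR_oplus_fwd {i j k : Kind}
      (S : Str α β .neg i) (G : Str α β .neg j) (D : Str α β .neg k) :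
      Derivable (S ⊢⁻ oplus G D) → Derivable (obslashR G S ⊢⁻ D)
  | obslashR_oplus_bwd {i j k : Kind}
      (G : Str α β .neg i) (S : Str α β .neg j) (D : Str α β .neg k) :
      Derivable (obslashR G S ⊢⁻ D) → Derivable (S ⊢⁻ oplus G D)
  | oslash_oplus_fwd {i j k : Kind} (X : Str α β .pos i) (D : Str α β .neg j) (G : Str α β .neg k) :
      Derivable (oslash X D ⊢⁰ G) → Derivable (X ⊢⁰ oplus G D)
  | oslash_oplus_bwd {i j k : Kind} (X : Str α β .pos i) (G : Str α β .neg j) (D : Str α β .neg k) :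
      Derivable (X ⊢⁰ oplus G D) → Derivable (oslash X D ⊢⁰ G)
  | obslash_oplus_fwd {i j k : Kind}
      (X : Str α β .pos i) (G : Str α β .neg j) (D : Str α β .neg k) :
      Derivable (X ⊢⁰ oplus G D) → Derivable (obslash G X ⊢⁰ D)
  | obslash_oplus_bwd {i j k : Kind}
      (G : Str α β .neg i) (X : Str α β .pos j) (D : Str α β .neg k) :
      Derivable (obslash G X ⊢⁰ D) → Derivable (X ⊢⁰ oplus G D)
  | obslash_oplusR_fwd {i j k : Kind}
      (G : Str α β .neg i) (X : Str α β .pos j) (Y : Str α β .pos k) :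
      Derivable (obslash G X ⊢⁺ Y) → Derivable (X ⊢⁺ oplusR G Y)
  | obslash_oplusR_bwd {i j k : Kind}
      (X : Str α β .pos i) (G : Str α β .neg j) (Y : Str α β .pos k) :
      Derivable (X ⊢⁺ oplusR G Y) → Derivable (obslash G X ⊢⁺ Y)
  | oslashR_oplusR_fwd {i j k : Kind}
      (X : Str α β .pos i) (G : Str α β .neg j) (Y : Str α β .pos k) :
      Derivable (X ⊢⁺ oplusR G Y) → Derivable (oslashR X Y ⊢⁻ G)
  | oslashR_oplusR_bwd {i j k : Kind}
      (X : Str α β .pos i) (Y : Str α β .pos j) (G : Str α β .neg k) :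
      Derivable (oslashR X Y ⊢⁻ G) → Derivable (X ⊢⁺ oplusR G Y)
  | oslash_oplusL_fwd {i j k : Kind}
      (X : Str α β .pos i) (D : Str α β .neg j) (Y : Str α β .pos k) :
      Derivable (oslash X D ⊢⁺ Y) → Derivable (X ⊢⁺ oplusL Y D)
  | oslash_oplusL_bwd {i j k : Kind}
      (X : Str α β .pos i) (Y : Str α β .pos j) (D : Str α β .neg k) :
      Derivable (X ⊢⁺ oplusL Y D) → Derivable (oslash X D ⊢⁺ Y)
  | obslashL_oplusL_fwd {i j k : Kind}
      (X : Str α β .pos i) (Y : Str α β .pos j) (D : Str α β .neg k) :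
      Derivable (X ⊢⁺ oplusL Y D) → Derivable (obslashL Y X ⊢⁻ D)
  | obslashL_oplusL_bwd {i j k : Kind}
      (Y : Str α β .pos i) (X : Str α β .pos j) (D : Str α β .neg k) :
      Derivable (obslashL Y X ⊢⁻ D) → Derivable (X ⊢⁺ oplusL Y D)
  | tensorR_bslash_fwd {i j k : Kind}
      (G : Str α β .neg i) (X : Str α β .pos j) (D : Str α β .neg k) :
      Derivable (G ⊢⁻ bslash X D) → Derivable (tensorR X G ⊢⁻ D)
  | tensorR_bslash_bwd {i j k : Kind}
      (X : Str α β .pos i) (G : Str α β .neg j) (D : Str α β .neg k) :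
      Derivable (tensorR X G ⊢⁻ D) → Derivable (G ⊢⁻ bslash X D)
  | tensorR_slashR_fwd {i j k : Kind}
      (X : Str α β .pos i) (G : Str α β .neg j) (D : Str α β .neg k) :
      Derivable (tensorR X G ⊢⁻ D) → Derivable (X ⊢⁺ slashR D G)
  | tensorR_slashR_bwd {i j k : Kind}
      (X : Str α β .pos i) (D : Str α β .neg j) (G : Str α β .neg k) :
      Derivable (X ⊢⁺ slashR D G) → Derivable (tensorR X G ⊢⁻ D)
  | tensorL_bslashL_fwd {i j k : Kind}
      (Y : Str α β .pos i) (G : Str α β .neg j) (D : Str α β .neg k) :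
      Derivable (Y ⊢⁺ bslashL G D) → Derivable (tensorL G Y ⊢⁻ D)
  | tensorL_bslashL_bwd {i j k : Kind}
      (G : Str α β .neg i) (Y : Str α β .pos j) (D : Str α β .neg k) :
      Derivable (tensorL G Y ⊢⁻ D) → Derivable (Y ⊢⁺ bslashL G D)
  | tensorL_slash_fwd {i j k : Kind}
      (G : Str α β .neg i) (Y : Str α β .pos j) (D : Str α β .neg k) :
      Derivable (tensorL G Y ⊢⁻ D) → Derivable (G ⊢⁻ slash D Y)
  | tensorL_slash_bwd {i j k : Kind}
      (G : Str α β .neg i) (D : Str α β .neg j) (Y : Str α β .pos k) :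
      Derivable (G ⊢⁻ slash D Y) → Derivable (tensorL G Y ⊢⁻ D)
  | up_downHarp_fwd (X : Str α β .pos .pure) (D : Str α β .neg .shifted) :
      Derivable (up X ⊢⁻ D) → Derivable (X ⊢⁺ downHarp D)
  | up_downHarp_bwd (X : Str α β .pos .pure) (D : Str α β .neg .shifted) :
      Derivable (X ⊢⁺ downHarp D) → Derivable (up X ⊢⁻ D)
  | up_down_fwd (X : Str α β .pos .pure) (D : Str α β .neg .pure) :
      Derivable (up X ⊢⁻ D) → Derivable (X ⊢⁺ down D)
  | up_down_bwd (X : Str α β .pos .pure) (D : Str α β .neg .pure) :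
      Derivable (X ⊢⁺ down D) → Derivable (up X ⊢⁻ D)
  | upHarp_down_fwd (X : Str α β .pos .shifted) (D : Str α β .neg .pure) :
      Derivable (X ⊢⁺ down D) → Derivable (upHarp X ⊢⁻ D)
  | upHarp_down_bwd (X : Str α β .pos .shifted) (D : Str α β .neg .pure) :
      Derivable (upHarp X ⊢⁻ D) → Derivable (X ⊢⁺ down D)
  -- structural rules
  | struct_down_fwd {i : Kind} (X : Str α β .pos i) (D : Str α β .neg .pure) :
      Derivable (X ⊢⁰ D) → Derivable (X ⊢⁺ down D)
  | struct_down_bwd {i : Kind} (X : Str α β .pos i) (D : Str α β .neg .pure) :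
      Derivable (X ⊢⁺ down D) → Derivable (X ⊢⁰ D)
  | struct_up_fwd {i : Kind} (X : Str α β .pos .pure) (D : Str α β .neg i) :
      Derivable (X ⊢⁰ D) → Derivable (up X ⊢⁻ D)
  | struct_up_bwd {i : Kind} (X : Str α β .pos .pure) (D : Str α β .neg i) :
      Derivable (up X ⊢⁻ D) → Derivable (X ⊢⁰ D)

/-! ## Standard sequents

The signed generation tree of a structure is traversed with a sign. A node is skeleton if it is
one of `⊗`, `⊘`, `⦸`, their variants, `↑`, `↿` with sign `plus`, or one of `⊕`, `\`, `/`, their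
variants, `↓`, `⇂` with sign `minus`. The sign is switched when passing to the first
argument of `⦸`, `\` and their variants and to the second argument of `⊘`, `/` and their variants. -/

inductive Sign
  | plus
  | minus

/-- The formula obtained by turning every connective of a structure into its operational
counterpart; undefined if a variant or an adjoint of a shift occurs. -/
def Str.form {α β : Type u} : {p : Polarity} → {k : Kind} → Str α β p k → Option (Fm α β p k)
  | _, _, .fm A => some A
  | _, _, .tensor X Y => Option.map₂ .tensor X.form Y.form
  | _, _, .oslash X Y => Option.map₂ .oslash X.form Y.form
  | _, _, .obslash X Y => Option.map₂ .obslash X.form Y.form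
  | _, _, .oplus X Y => Option.map₂ .oplus X.form Y.form
  | _, _, .bslash X Y => Option.map₂ .bslash X.form Y.form
  | _, _, .slash X Y => Option.map₂ .slash X.form Y.form
  | _, _, .tensorL _ _ => none
  | _, _, .tensorR _ _ => none
  | _, _, .oslashL _ _ => none
  | _, _, .oslashR _ _ => none
  | _, _, .obslashL _ _ => none
  | _, _, .obslashR _ _ => none
  | _, _, .oplusL _ _ => none
  | _, _, .oplusR _ _ => none
  | _, _, .bslashL _ _ => none
  | _, _, .bslashR _ _ => none
  | _, _, .slashL _ _ => none
  | _, _, .slashR _ _ => none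
  | _, _, .down X => X.form.map .down
  | _, _, .downHarp _ => none
  | _, _, .up X => X.form.map .up
  | _, _, .upHarp _ => none

/-- For a formula: the connectives of the principal subtree become structural if this subtree is
skeleton, all the others stay operational. -/
def Fm.std {α β : Type u} : Sign → {p : Polarity} → {k : Kind} → Fm α β p k → Str α β p k
  | _, _, _, .posAtom a => .fm (.posAtom a)
  | _, _, _, .negAtom b => .fm (.negAtom b)
  | .plus, _, _, .tensor A B => .tensor (A.std .plus) (B.std .plus)
  | .minus, _, _, .tensor A B => .fm (.tensor A B)
  | .plus, _, _, .oslash A B => .oslash (A.std .plus) (B.std .minus)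
  | .minus, _, _, .oslash A B => .fm (.oslash A B)
  | .plus, _, _, .obslash A B => .obslash (A.std .minus) (B.std .plus)
  | .minus, _, _, .obslash A B => .fm (.obslash A B)
  | .minus, _, _, .oplus A B => .oplus (A.std .minus) (B.std .minus)
  | .plus, _, _, .oplus A B => .fm (.oplus A B)
  | .minus, _, _, .bslash A B => .bslash (A.std .plus) (B.std .minus)
  | .plus, _, _, .bslash A B => .fm (.bslash A B)
  | .minus, _, _, .slash A B => .slash (A.std .minus) (B.std .plus)
  | .plus, _, _, .slash A B => .fm (.slash A B)
  | .minus, _, _, .down A => .down (A.std .minus)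
  | .plus, _, _, .down A => .fm (.down A)
  | .plus, _, _, .up A => .up (A.std .plus)
  | .minus, _, _, .up A => .fm (.up A)

/-- `Ψ.std .plus` is `Ftom(Ψ)` and `Ψ.std .minus` is `FtoM(Ψ)`: the connectives of the principal
subtree of the signed generation tree of `Ψ` become structural if this subtree is skeleton and
operational if it is PIA, and all the other connectives become operational. It is `none` if one
of the connectives to be made operational has no operational counterpart. -/
def Str.std {α β : Type u} :
    Sign → {p : Polarity} → {k : Kind} → Str α β p k → Option (Str α β p k)
  | s, _, _, .fm A => some (A.std s)
  | .plus, _, _, .tensor X Y => Option.map₂ .tensor (X.std .plus) (Y.std .plus)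
  | .minus, _, _, .tensor X Y => (Str.tensor X Y).form.map .fm
  | .plus, _, _, .oslash X Y => Option.map₂ .oslash (X.std .plus) (Y.std .minus)
  | .minus, _, _, .oslash X Y => (Str.oslash X Y).form.map .fm
  | .plus, _, _, .obslash X Y => Option.map₂ .obslash (X.std .minus) (Y.std .plus)
  | .minus, _, _, .obslash X Y => (Str.obslash X Y).form.map .fm
  | .minus, _, _, .oplus X Y => Option.map₂ .oplus (X.std .minus) (Y.std .minus)
  | .plus, _, _, .oplus X Y => (Str.oplus X Y).form.map .fm
  | .minus, _, _, .bslash X Y => Option.map₂ .bslash (X.std .plus) (Y.std .minus)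
  | .plus, _, _, .bslash X Y => (Str.bslash X Y).form.map .fm
  | .minus, _, _, .slash X Y => Option.map₂ .slash (X.std .minus) (Y.std .plus)
  | .plus, _, _, .slash X Y => (Str.slash X Y).form.map .fm
  | .plus, _, _, .tensorL X Y => Option.map₂ .tensorL (X.std .plus) (Y.std .plus)
  | .minus, _, _, .tensorL _ _ => none
  | .plus, _, _, .tensorR X Y => Option.map₂ .tensorR (X.std .plus) (Y.std .plus)
  | .minus, _, _, .tensorR _ _ => none
  | .plus, _, _, .oslashL X Y => Option.map₂ .oslashL (X.std .plus) (Y.std .minus)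
  | .minus, _, _, .oslashL _ _ => none
  | .plus, _, _, .oslashR X Y => Option.map₂ .oslashR (X.std .plus) (Y.std .minus)
  | .minus, _, _, .oslashR _ _ => none
  | .plus, _, _, .obslashL X Y => Option.map₂ .obslashL (X.std .minus) (Y.std .plus)
  | .minus, _, _, .obslashL _ _ => none
  | .plus, _, _, .obslashR X Y => Option.map₂ .obslashR (X.std .minus) (Y.std .plus)
  | .minus, _, _, .obslashR _ _ => none
  | .minus, _, _, .oplusL X Y => Option.map₂ .oplusL (X.std .minus) (Y.std .minus)
  | .plus, _, _, .oplusL _ _ => none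
  | .minus, _, _, .oplusR X Y => Option.map₂ .oplusR (X.std .minus) (Y.std .minus)
  | .plus, _, _, .oplusR _ _ => none
  | .minus, _, _, .bslashL X Y => Option.map₂ .bslashL (X.std .plus) (Y.std .minus)
  | .plus, _, _, .bslashL _ _ => none
  | .minus, _, _, .bslashR X Y => Option.map₂ .bslashR (X.std .plus) (Y.std .minus)
  | .plus, _, _, .bslashR _ _ => none
  | .minus, _, _, .slashL X Y => Option.map₂ .slashL (X.std .minus) (Y.std .plus)
  | .plus, _, _, .slashL _ _ => none
  | .minus, _, _, .slashR X Y => Option.map₂ .slashR (X.std .minus) (Y.std .plus)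
  | .plus, _, _, .slashR _ _ => none
  | .minus, _, _, .down X => (X.std .minus).map .down
  | .plus, _, _, .down X => (Str.down X).form.map .fm
  | .minus, _, _, .downHarp X => (X.std .minus).map .downHarp
  | .plus, _, _, .downHarp _ => none
  | .plus, _, _, .up X => (X.std .plus).map .up
  | .minus, _, _, .up X => (Str.up X).form.map .fm
  | .plus, _, _, .upHarp X => (X.std .plus).map .upHarp
  | .minus, _, _, .upHarp _ => none

/-- `Ψ.Ftom`, the version of `Ψ` for the left-hand side of a standard sequent. -/
abbrev Str.Ftom {α β : Type u} {p : Polarity} {k : Kind} (X : Str α β p k) :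
    Option (Str α β p k) := X.std .plus

/-- `Ψ.FtoM`, the version of `Ψ` for the right-hand side of a standard sequent. -/
abbrev Str.FtoM {α β : Type u} {p : Polarity} {k : Kind} (X : Str α β p k) :
    Option (Str α β p k) := X.std .minus

/-- The standard sequent of `Ψ t Φ`, namely `Ftom(Ψ) t FtoM(Φ)`, when it is defined. -/
def Sequent.standard {α β : Type u} : Sequent α β → Option (Sequent α β)
  | .pos X Y => Option.map₂ .pos X.Ftom Y.FtoM
  | .neg X Y => Option.map₂ .neg X.Ftom Y.FtoM
  | .neutral X Y => Option.map₂ .neutral X.Ftom Y.FtoM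

/-! ## Fully polarized LG-algebras -/

/-- A relation between two posets which is compatible with their orders. -/
def IsWeakening {A B : Type u} [PartialOrder A] [PartialOrder B] (R : A → B → Prop) : Prop :=
  ∀ ⦃a' a : A⦄ ⦃b b' : B⦄, a' ≤ a → R a b → b ≤ b' → R a' b'

/-- The collage order on the disjoint union of two posets `A` and `B` given by a weakening relation
from `A` to `B`. -/
def collageLE {A B : Type u} [PartialOrder A] [PartialOrder B] (R : A → B → Prop) :
    A ⊕ B → A ⊕ B → Prop
  | .inl a, .inl a' => a ≤ a'
  | .inl a, .inr b => R a b
  | .inr b, .inr b' => b ≤ b'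
  | .inr _, .inl _ => False

/-- `f` is order-preserving in both arguments, with respect to the given orders. -/
def Monotone₂ {A B C : Type u} (leA : A → A → Prop) (leB : B → B → Prop) (leC : C → C → Prop)
    (f : A → B → C) : Prop :=
  ∀ ⦃a a' : A⦄ ⦃b b' : B⦄, leA a a' → leB b b' → leC (f a b) (f a' b')

/-- The four posets of a fully polarized LG-algebra, with the shifts and the weakening
relations. The axioms `relN_up`, `relP_down` say that `rel` is represented by the heterogeneous
adjunction between `up` and `down`. -/
structure PolarizedFrame where
  /-- pure positive elements -/
  P : Type u
  /-- shifted positive elements -/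
  SP : Type u
  /-- pure negative elements -/
  N : Type u
  /-- shifted negative elements -/
  SN : Type u
  [instP : PartialOrder P]
  [instSP : PartialOrder SP]
  [instN : PartialOrder N]
  [instSN : PartialOrder SN]
  up : P → SN
  downHarp : SN → P
  upHarp : SP → N
  down : N → SP
  up_downHarp : GaloisConnection up downHarp
  upHarp_down : GaloisConnection upHarp down
  /-- weakening relation from pure to shifted positive elements -/
  relP : P → SP → Prop
  /-- weakening relation from pure positive to pure negative elements -/
  rel : P → N → Prop
  /-- weakening relation from shifted to pure negative elements -/
  relN : SN → N → Prop
  relP_weakening : IsWeakening relP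
  rel_weakening : IsWeakening rel
  relN_weakening : IsWeakening relN
  relN_up : ∀ (x : P) (n : N), relN (up x) n ↔ rel x n
  relP_down : ∀ (x : P) (n : N), relP x (down n) ↔ rel x n

namespace PolarizedFrame

attribute [instance] instP instSP instN instSN

variable (A : PolarizedFrame.{u})

/-- General positive elements. -/
abbrev GP : Type u := A.P ⊕ A.SP

/-- General negative elements. The shifted ones are the left summand because the weakening relation
`relN` goes from shifted to pure elements. -/
abbrev GN : Type u := A.SN ⊕ A.N

/-- The collage order on general positive elements. -/
def leP : A.GP → A.GP → Prop := collageLE A.relP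

/-- The collage order on general negative elements. -/
def leN : A.GN → A.GN → Prop := collageLE A.relN

/-- The collage weakening relation from general positive to general negative elements. On
`P × SN` it is the relation represented by the adjunction `↑ ⊣ ⇂`, on `SP × N` the one represented
by `↿ ⊣ ↓`. -/
def turn : A.GP → A.GN → Prop
  | .inl x, .inl n => A.up x ≤ n
  | .inl x, .inr n => A.rel x n
  | .inr x, .inr n => A.upHarp x ≤ n
  | .inr _, .inl _ => False

/-- A pure positive element as a general one. -/
abbrev inP (x : A.P) : A.GP := .inl x

/-- A shifted positive element as a general one. -/
abbrev inSP (x : A.SP) : A.GP := .inr x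

/-- A pure negative element as a general one. -/
abbrev inN (n : A.N) : A.GN := .inr n

/-- A shifted negative element as a general one. -/
abbrev inSN (n : A.SN) : A.GN := .inl n

end PolarizedFrame

open PolarizedFrame in
/-- Fully polarized LG-algebras. -/
structure FPLGAlgebra extends PolarizedFrame.{u} where
  tensor : toPolarizedFrame.GP → toPolarizedFrame.GP → P
  oslash : toPolarizedFrame.GP → toPolarizedFrame.GN → P
  obslash : toPolarizedFrame.GN → toPolarizedFrame.GP → P
  oplus : toPolarizedFrame.GN → toPolarizedFrame.GN → N
  bslash : toPolarizedFrame.GP → toPolarizedFrame.GN → N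
  slash : toPolarizedFrame.GN → toPolarizedFrame.GP → N
  tensorL : toPolarizedFrame.GN → toPolarizedFrame.GP → SN
  tensorR : toPolarizedFrame.GP → toPolarizedFrame.GN → SN
  oslashL : toPolarizedFrame.GN → toPolarizedFrame.GN → SN
  oslashR : toPolarizedFrame.GP → toPolarizedFrame.GP → SN
  obslashL : toPolarizedFrame.GP → toPolarizedFrame.GP → SN
  obslashR : toPolarizedFrame.GN → toPolarizedFrame.GN → SN
  oplusL : toPolarizedFrame.GP → toPolarizedFrame.GN → SP
  oplusR : toPolarizedFrame.GN → toPolarizedFrame.GP → SP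
  bslashL : toPolarizedFrame.GN → toPolarizedFrame.GN → SP
  bslashR : toPolarizedFrame.GP → toPolarizedFrame.GP → SP
  slashL : toPolarizedFrame.GP → toPolarizedFrame.GP → SP
  slashR : toPolarizedFrame.GN → toPolarizedFrame.GN → SP
  -- order-preservation, where a source marked with `∂` carries the dual order
  tensor_mono : Monotone₂ toPolarizedFrame.leP toPolarizedFrame.leP (· ≤ ·) tensor
  oslash_mono : Monotone₂ toPolarizedFrame.leP (flip toPolarizedFrame.leN) (· ≤ ·) oslash
  obslash_mono : Monotone₂ (flip toPolarizedFrame.leN) toPolarizedFrame.leP (· ≤ ·) obslash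
  oplus_mono : Monotone₂ toPolarizedFrame.leN toPolarizedFrame.leN (· ≤ ·) oplus
  bslash_mono : Monotone₂ (flip toPolarizedFrame.leP) toPolarizedFrame.leN (· ≤ ·) bslash
  slash_mono : Monotone₂ toPolarizedFrame.leN (flip toPolarizedFrame.leP) (· ≤ ·) slash
  tensorL_mono : Monotone₂ toPolarizedFrame.leN toPolarizedFrame.leP (· ≤ ·) tensorL
  tensorR_mono : Monotone₂ toPolarizedFrame.leP toPolarizedFrame.leN (· ≤ ·) tensorR
  oslashL_mono : Monotone₂ toPolarizedFrame.leN (flip toPolarizedFrame.leN) (· ≤ ·) oslashL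
  oslashR_mono : Monotone₂ toPolarizedFrame.leP (flip toPolarizedFrame.leP) (· ≤ ·) oslashR
  obslashL_mono : Monotone₂ (flip toPolarizedFrame.leP) toPolarizedFrame.leP (· ≤ ·) obslashL
  obslashR_mono : Monotone₂ (flip toPolarizedFrame.leN) toPolarizedFrame.leN (· ≤ ·) obslashR
  oplusL_mono : Monotone₂ toPolarizedFrame.leP toPolarizedFrame.leN (· ≤ ·) oplusL
  oplusR_mono : Monotone₂ toPolarizedFrame.leN toPolarizedFrame.leP (· ≤ ·) oplusR
  bslashL_mono : Monotone₂ (flip toPolarizedFrame.leN) toPolarizedFrame.leN (· ≤ ·) bslashL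
  bslashR_mono : Monotone₂ (flip toPolarizedFrame.leP) toPolarizedFrame.leP (· ≤ ·) bslashR
  slashL_mono : Monotone₂ toPolarizedFrame.leP (flip toPolarizedFrame.leP) (· ≤ ·) slashL
  slashR_mono : Monotone₂ toPolarizedFrame.leN (flip toPolarizedFrame.leN) (· ≤ ·) slashR
  -- adjunctions of the connectives
  tensor_bslash : ∀ (p : toPolarizedFrame.GP) (q : toPolarizedFrame.GP) (n : toPolarizedFrame.GN),
    toPolarizedFrame.turn (inP _ (tensor p q)) n ↔ toPolarizedFrame.turn q (inN _ (bslash p n))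
  tensor_slash : ∀ (p : toPolarizedFrame.GP) (q : toPolarizedFrame.GP) (n : toPolarizedFrame.GN),
    toPolarizedFrame.turn (inP _ (tensor p q)) n ↔ toPolarizedFrame.turn p (inN _ (slash n q))
  oslash_oplus : ∀ (p : toPolarizedFrame.GP) (m : toPolarizedFrame.GN) (n : toPolarizedFrame.GN),
    toPolarizedFrame.turn (inP _ (oslash p n)) m ↔ toPolarizedFrame.turn p (inN _ (oplus m n))
  obslash_oplus : ∀ (p : toPolarizedFrame.GP) (m : toPolarizedFrame.GN) (n : toPolarizedFrame.GN),
    toPolarizedFrame.turn (inP _ (obslash m p)) n ↔ toPolarizedFrame.turn p (inN _ (oplus m n))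
  -- adjunctions of the variants
  tensor_bslashR : ∀ (p : toPolarizedFrame.GP) (q : toPolarizedFrame.GP) (r : toPolarizedFrame.GP),
    toPolarizedFrame.leP (inP _ (tensor p q)) r ↔ toPolarizedFrame.leP q (inSP _ (bslashR p r))
  tensor_slashL : ∀ (p : toPolarizedFrame.GP) (q : toPolarizedFrame.GP) (r : toPolarizedFrame.GP),
    toPolarizedFrame.leP (inP _ (tensor p q)) r ↔ toPolarizedFrame.leP p (inSP _ (slashL r q))
  oslashL_oplus : ∀ (l : toPolarizedFrame.GN) (m : toPolarizedFrame.GN) (n : toPolarizedFrame.GN),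
    toPolarizedFrame.leN (inSN _ (oslashL l n)) m ↔ toPolarizedFrame.leN l (inN _ (oplus m n))
  obslashR_oplus : ∀ (l : toPolarizedFrame.GN) (m : toPolarizedFrame.GN) (n : toPolarizedFrame.GN),
    toPolarizedFrame.leN (inSN _ (obslashR m l)) n ↔ toPolarizedFrame.leN l (inN _ (oplus m n))
  tensorL_bslashL : ∀ (l : toPolarizedFrame.GN) (q : toPolarizedFrame.GP) (n : toPolarizedFrame.GN),
    toPolarizedFrame.leN (inSN _ (tensorL l q)) n ↔ toPolarizedFrame.leP q (inSP _ (bslashL l n))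
  tensorL_slash : ∀ (l : toPolarizedFrame.GN) (q : toPolarizedFrame.GP) (n : toPolarizedFrame.GN),
    toPolarizedFrame.leN (inSN _ (tensorL l q)) n ↔ toPolarizedFrame.leN l (inN _ (slash n q))
  oslashR_oplusR : ∀ (p : toPolarizedFrame.GP) (r : toPolarizedFrame.GP) (m : toPolarizedFrame.GN),
    toPolarizedFrame.leN (inSN _ (oslashR p r)) m ↔ toPolarizedFrame.leP p (inSP _ (oplusR m r))
  obslash_oplusR : ∀ (p : toPolarizedFrame.GP) (r : toPolarizedFrame.GP) (m : toPolarizedFrame.GN),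
    toPolarizedFrame.leP (inP _ (obslash m p)) r ↔ toPolarizedFrame.leP p (inSP _ (oplusR m r))
  tensorR_bslash : ∀ (p : toPolarizedFrame.GP) (l : toPolarizedFrame.GN) (n : toPolarizedFrame.GN),
    toPolarizedFrame.leN (inSN _ (tensorR p l)) n ↔ toPolarizedFrame.leN l (inN _ (bslash p n))
  tensorR_slashR : ∀ (p : toPolarizedFrame.GP) (l : toPolarizedFrame.GN) (n : toPolarizedFrame.GN),
    toPolarizedFrame.leN (inSN _ (tensorR p l)) n ↔ toPolarizedFrame.leP p (inSP _ (slashR n l))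
  oslash_oplusL : ∀ (p : toPolarizedFrame.GP) (r : toPolarizedFrame.GP) (n : toPolarizedFrame.GN),
    toPolarizedFrame.leP (inP _ (oslash p n)) r ↔ toPolarizedFrame.leP p (inSP _ (oplusL r n))
  obslashL_oplusL : ∀ (p : toPolarizedFrame.GP) (r : toPolarizedFrame.GP) (n : toPolarizedFrame.GN),
    toPolarizedFrame.leN (inSN _ (obslashL r p)) n ↔ toPolarizedFrame.leP p (inSP _ (oplusL r n))

/-! ## Interpretation -/

namespace FPLGAlgebra

/-- The poset in which structures of a given sort are interpreted. -/
def Carrier (A : FPLGAlgebra.{u}) : Polarity → Kind → Type u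
  | .pos, .pure => A.P
  | .pos, .shifted => A.SP
  | .neg, .pure => A.N
  | .neg, .shifted => A.SN

/-- The inclusion into the general positive elements. -/
def toGP (A : FPLGAlgebra.{u}) : {k : Kind} → A.Carrier .pos k → A.GP
  | .pure, x => A.inP x
  | .shifted, x => A.inSP x

/-- The inclusion into the general negative elements. -/
def toGN (A : FPLGAlgebra.{u}) : {k : Kind} → A.Carrier .neg k → A.GN
  | .pure, n => A.inN n
  | .shifted, n => A.inSN n

end FPLGAlgebra

/-- An interpretation of the letters: positive ones by pure positive elements, negative ones by pure
negative elements. -/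
structure Valuation (α β : Type u) (A : FPLGAlgebra.{u}) where
  pos : α → A.P
  neg : β → A.N

/-- The homomorphic extension of an interpretation to formulas. -/
def Fm.interp {α β : Type u} {A : FPLGAlgebra.{u}} (v : Valuation α β A) :
    {p : Polarity} → {k : Kind} → Fm α β p k → A.Carrier p k
  | _, _, .posAtom a => v.pos a
  | _, _, .negAtom b => v.neg b
  | _, _, .tensor B C => A.tensor (A.toGP (B.interp v)) (A.toGP (C.interp v))
  | _, _, .oslash B C => A.oslash (A.toGP (B.interp v)) (A.toGN (C.interp v))
  | _, _, .obslash B C => A.obslash (A.toGN (B.interp v)) (A.toGP (C.interp v))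
  | _, _, .oplus B C => A.oplus (A.toGN (B.interp v)) (A.toGN (C.interp v))
  | _, _, .bslash B C => A.bslash (A.toGP (B.interp v)) (A.toGN (C.interp v))
  | _, _, .slash B C => A.slash (A.toGN (B.interp v)) (A.toGP (C.interp v))
  | _, _, .down B => A.down (B.interp v)
  | _, _, .up B => A.up (B.interp v)

/-- The homomorphic extension of an interpretation to structures. -/
def Str.interp {α β : Type u} {A : FPLGAlgebra.{u}} (v : Valuation α β A) :
    {p : Polarity} → {k : Kind} → Str α β p k → A.Carrier p k
  | _, _, .fm B => B.interp v
  | _, _, .tensor X Y => A.tensor (A.toGP (X.interp v)) (A.toGP (Y.interp v))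
  | _, _, .oslash X Y => A.oslash (A.toGP (X.interp v)) (A.toGN (Y.interp v))
  | _, _, .obslash X Y => A.obslash (A.toGN (X.interp v)) (A.toGP (Y.interp v))
  | _, _, .oplus X Y => A.oplus (A.toGN (X.interp v)) (A.toGN (Y.interp v))
  | _, _, .bslash X Y => A.bslash (A.toGP (X.interp v)) (A.toGN (Y.interp v))
  | _, _, .slash X Y => A.slash (A.toGN (X.interp v)) (A.toGP (Y.interp v))
  | _, _, .tensorL X Y => A.tensorL (A.toGN (X.interp v)) (A.toGP (Y.interp v))
  | _, _, .tensorR X Y => A.tensorR (A.toGP (X.interp v)) (A.toGN (Y.interp v))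
  | _, _, .oslashL X Y => A.oslashL (A.toGN (X.interp v)) (A.toGN (Y.interp v))
  | _, _, .oslashR X Y => A.oslashR (A.toGP (X.interp v)) (A.toGP (Y.interp v))
  | _, _, .obslashL X Y => A.obslashL (A.toGP (X.interp v)) (A.toGP (Y.interp v))
  | _, _, .obslashR X Y => A.obslashR (A.toGN (X.interp v)) (A.toGN (Y.interp v))
  | _, _, .oplusL X Y => A.oplusL (A.toGP (X.interp v)) (A.toGN (Y.interp v))
  | _, _, .oplusR X Y => A.oplusR (A.toGN (X.interp v)) (A.toGP (Y.interp v))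
  | _, _, .bslashL X Y => A.bslashL (A.toGN (X.interp v)) (A.toGN (Y.interp v))
  | _, _, .bslashR X Y => A.bslashR (A.toGP (X.interp v)) (A.toGP (Y.interp v))
  | _, _, .slashL X Y => A.slashL (A.toGP (X.interp v)) (A.toGP (Y.interp v))
  | _, _, .slashR X Y => A.slashR (A.toGN (X.interp v)) (A.toGN (Y.interp v))
  | _, _, .down X => A.down (X.interp v)
  | _, _, .downHarp X => A.downHarp (X.interp v)
  | _, _, .up X => A.up (X.interp v)
  | _, _, .upHarp X => A.upHarp (X.interp v)

/-- Truth of a sequent under an interpretation: the positive, negative and neutral turnstiles are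
interpreted by the (components of the) two collage orders and the collage weakening relation. -/
def Sequent.Holds {α β : Type u} {A : FPLGAlgebra.{u}} (v : Valuation α β A) :
    Sequent α β → Prop
  | .pos X Y => A.leP (A.toGP (X.interp v)) (A.toGP (Y.interp v))
  | .neg X Y => A.leN (A.toGN (X.interp v)) (A.toGN (Y.interp v))
  | .neutral X Y => A.turn (A.toGP (X.interp v)) (A.toGN (Y.interp v))

/-- Validity: truth under all interpretations in all fully polarized LG-algebras. -/
def Sequent.Valid {α β : Type u} (S : Sequent α β) : Prop :=
  ∀ (A : FPLGAlgebra.{u}) (v : Valuation α β A), S.Holds v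

end FDLG

/-!
Completeness is proved with a single algebra, built from the calculus itself. A positive element is
a set of positive structures, ordered by inclusion, and a negative element a set of negative
structures, ordered by reverse inclusion. Members of positive elements are thought of as values,
those of negative elements as continuations, and the derivable neutral sequents as a pole: all
shifts are orthogonals with respect to it, and the relation `≼` is orthogonality, except that it is
empty between shifted elements (`setFrame`). The six connectives
form the set of all structures `X ⊗ Y` etc. with `X` and `Y` from the arguments, and the variants
are defined as residuals. With these choices the adjunctions of neutral sequents are exactly
display postulates, and all the others hold for purely set-theoretic reasons (`setAlgebra`). No
closure operator is involved.

Each letter is interpreted by its singleton. Then a structure `Ψ` is bounded by its standard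
versions (`Str.approximates_std`): for a positive `Ψ`, the structure `Ftom(Ψ)` is a member of the
interpretation of `Ψ`, and all its members derive `FtoM(Ψ)`; for a negative one, `FtoM(Ψ)` is a
member, and `Ftom(Ψ)` derives all the members. If a sequent holds in the algebra, then
instantiating its truth at these members gives a derivation of the standard sequent.

Two points make the induction work. The translation rules for the binary connectives apply only
when the arguments are formulas, which suffices by display (`Fm.folds`). And pure elements
consist of pure structures only, whereas shifted elements contain structures of both kinds: the
non-invertible rules for `↓` and `↑` apply to pure structures only, while `↓ N` itself has to belong
to its interpretation. No cut is used.
-/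

namespace FDLG

open PolarizedFrame

variable {α β : Type u}

/-! ### The frame of sets of structures -/

/-- Structures of a given polarity, pure or shifted. -/
abbrev GStr (α β : Type u) (p : Polarity) : Type u := Σ k : Kind, Str α β p k

/-- The positive structures orthogonal to all the members of a set of negative structures. -/
def negOrth (n : Set (GStr α β .neg)) : Set (GStr α β .pos) :=
  {X | ∀ D ∈ n, Derivable (X.2 ⊢⁰ D.2)}

/-- The negative structures orthogonal to all the members of a set of positive structures. -/
def posOrth (a : Set (GStr α β .pos)) : Set (GStr α β .neg) :=
  {D | ∀ X ∈ a, Derivable (X.2 ⊢⁰ D.2)}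

/-- The frame of sets of structures. A pure element is a set of pure structures, a shifted element
a set of arbitrary ones. Sets of positive structures are ordered by inclusion, sets of negative
structures by reverse inclusion, and all shifts are orthogonals. -/
def setFrame (α β : Type u) : PolarizedFrame.{u} where
  P := Set (Str α β .pos .pure)
  SP := Set (GStr α β .pos)
  N := (Set (Str α β .neg .pure))ᵒᵈ
  SN := (Set (GStr α β .neg))ᵒᵈ
  up a := OrderDual.toDual (posOrth (Sigma.mk _ '' a))
  downHarp m := Sigma.mk _ ⁻¹' negOrth (OrderDual.ofDual m)
  upHarp b := OrderDual.toDual (Sigma.mk _ ⁻¹' posOrth b)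
  down n := negOrth (Sigma.mk _ '' OrderDual.ofDual n)
  up_downHarp a m :=
    ⟨fun (h : OrderDual.ofDual m ⊆ posOrth (Sigma.mk _ '' a)) X hX D hD => h hD _ ⟨X, hX, rfl⟩,
      by rintro h D hD _ ⟨X, hX, rfl⟩; exact h hX D hD⟩
  upHarp_down b n :=
    ⟨by rintro h X hX _ ⟨D, hD, rfl⟩; exact h hD X hX,
      fun (h : b ⊆ negOrth (Sigma.mk _ '' OrderDual.ofDual n)) D hD X hX =>
        h hX _ ⟨D, hD, rfl⟩⟩
  relP a b := Sigma.mk _ '' a ⊆ b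
  rel a n := ∀ X ∈ a, ∀ D ∈ OrderDual.ofDual n, Derivable (X ⊢⁰ D)
  relN m n := Sigma.mk _ '' OrderDual.ofDual n ⊆ OrderDual.ofDual m
  relP_weakening _ _ _ _ h₁ h h₂ := (Set.image_mono h₁).trans (h.trans h₂)
  rel_weakening _ _ _ _ h₁ h h₂ X hX D hD := h X (h₁ hX) D (h₂ hD)
  relN_weakening _ _ _ _ h₁ h h₂ := (Set.image_mono h₂).trans (h.trans h₁)
  relN_up a n :=
    ⟨fun h X hX D hD => h ⟨D, hD, rfl⟩ _ ⟨X, hX, rfl⟩,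
      by rintro h _ ⟨D, hD, rfl⟩ _ ⟨X, hX, rfl⟩; exact h X hX D hD⟩
  relP_down a n :=
    ⟨fun h X hX D hD => h ⟨X, hX, rfl⟩ _ ⟨D, hD, rfl⟩,
      by rintro h _ ⟨X, hX, rfl⟩ _ ⟨D, hD, rfl⟩; exact h X hX D hD⟩

/-- The structures belonging to a general positive element. -/
def posVal : (setFrame α β).GP → Set (GStr α β .pos)
  | .inl a => Sigma.mk Kind.pure '' (a : Set (Str α β .pos .pure))
  | .inr b => b

/-- The structures belonging to a general negative element. -/
def negVal : (setFrame α β).GN → Set (GStr α β .neg)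
  | .inl m => OrderDual.ofDual m
  | .inr n => Sigma.mk Kind.pure '' (OrderDual.ofDual n : Set (Str α β .neg .pure))

theorem posVal_subset_of_leP {p q : (setFrame α β).GP} (h : (setFrame α β).leP p q) :
    posVal p ⊆ posVal q := by
  cases p <;> cases q
  · exact Set.image_mono h
  · exact h
  · exact h.elim
  · exact h

theorem negVal_subset_of_leN {m n : (setFrame α β).GN} (h : (setFrame α β).leN m n) :
    negVal n ⊆ negVal m := by
  cases m <;> cases n
  · exact h
  · exact h
  · exact h.elim
  · exact Set.image_mono h

/-- The converse of `posVal_subset_of_leP` can fail only from shifted to pure elements, which are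
never comparable. -/
theorem leP_inP_iff {a : Set (Str α β .pos .pure)} {q : (setFrame α β).GP} :
    (setFrame α β).leP (inP (setFrame α β) a) q ↔
      ∀ X ∈ a, ⟨.pure, X⟩ ∈ posVal q := by
  refine ⟨fun h X hX => posVal_subset_of_leP h ⟨X, hX, rfl⟩, fun h => ?_⟩
  cases q
  · intro X hX
    obtain ⟨Y, hY, e⟩ := h X hX
    cases e
    exact hY
  · rintro _ ⟨X, hX, rfl⟩
    exact h X hX

theorem leP_inSP_iff {p : (setFrame α β).GP} {b : Set (GStr α β .pos)} :
    (setFrame α β).leP p (inSP (setFrame α β) b) ↔ ∀ X ∈ posVal p, X ∈ b := by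
  cases p <;> exact Iff.rfl

theorem leN_inN_iff {m : (setFrame α β).GN} {n : (Set (Str α β .neg .pure))ᵒᵈ} :
    (setFrame α β).leN m (inN (setFrame α β) n) ↔
      ∀ D ∈ OrderDual.ofDual n, ⟨.pure, D⟩ ∈ negVal m := by
  refine ⟨fun h X hX => negVal_subset_of_leN h ⟨X, hX, rfl⟩, fun h => ?_⟩
  cases m
  · rintro _ ⟨X, hX, rfl⟩
    exact h X hX
  · intro X hX
    obtain ⟨Y, hY, e⟩ := h X hX
    cases e
    exact hY

theorem leN_inSN_iff {m : (Set (GStr α β .neg))ᵒᵈ} {n : (setFrame α β).GN} :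
    (setFrame α β).leN (inSN (setFrame α β) m) n ↔
      ∀ D ∈ negVal n, D ∈ OrderDual.ofDual m := by
  cases n <;> exact Iff.rfl

theorem derivable_of_turn {p : (setFrame α β).GP} {n : (setFrame α β).GN}
    (h : (setFrame α β).turn p n) :
    ∀ X ∈ posVal p, ∀ D ∈ negVal n, Derivable (X.2 ⊢⁰ D.2) := by
  intro X hX D hD
  cases p <;> cases n
  · exact h hD X hX
  · obtain ⟨X, hX, rfl⟩ := hX
    obtain ⟨D, hD, rfl⟩ := hD
    exact h X hX D hD
  · exact h.elim
  · obtain ⟨D, hD, rfl⟩ := hD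
    exact h hD X hX

theorem turn_inP_iff {a : Set (Str α β .pos .pure)} {n : (setFrame α β).GN} :
    (setFrame α β).turn (inP (setFrame α β) a) n ↔
      ∀ X ∈ a, ∀ D ∈ negVal n, Derivable (X ⊢⁰ D.2) := by
  refine ⟨fun h X hX => derivable_of_turn h _ ⟨X, hX, rfl⟩, fun h => ?_⟩
  cases n
  · rintro D hD _ ⟨X, hX, rfl⟩
    exact h X hX D hD
  · exact fun X hX D hD => h X hX _ ⟨D, hD, rfl⟩

theorem turn_inN_iff {p : (setFrame α β).GP} {n : (Set (Str α β .neg .pure))ᵒᵈ} :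
    (setFrame α β).turn p (inN (setFrame α β) n) ↔
      ∀ X ∈ posVal p, ∀ D ∈ OrderDual.ofDual n,
        Derivable (X.2 ⊢⁰ D) := by
  refine ⟨fun h X hX D hD => derivable_of_turn h X hX _ ⟨D, hD, rfl⟩, fun h => ?_⟩
  cases p
  · exact fun X hX D hD => h _ ⟨X, hX, rfl⟩ D hD
  · exact fun D hD X hX => h X hX D hD

/-! ### The algebra of sets of structures -/

/-- The fully polarized LG-algebra of sets of structures. The six connectives act elementwise by
their structural counterparts, and each variant is the residual of a connective with respect to
inclusion. -/
def setAlgebra (α β : Type u) : FPLGAlgebra.{u} where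
  toPolarizedFrame := setFrame α β
  tensor p q := Set.image2 (fun X Y => Str.tensor X.2 Y.2) (posVal p) (posVal q)
  oslash p n := Set.image2 (fun X Y => Str.oslash X.2 Y.2) (posVal p) (negVal n)
  obslash n p := Set.image2 (fun X Y => Str.obslash X.2 Y.2) (negVal n) (posVal p)
  oplus m n := OrderDual.toDual (Set.image2 (fun X Y => Str.oplus X.2 Y.2) (negVal m) (negVal n))
  bslash p n := OrderDual.toDual (Set.image2 (fun X Y => Str.bslash X.2 Y.2) (posVal p) (negVal n))
  slash n p := OrderDual.toDual (Set.image2 (fun X Y => Str.slash X.2 Y.2) (negVal n) (posVal p))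
  tensorL l q := OrderDual.toDual {Z | ∀ Y ∈ posVal q, ⟨.pure, .slash Z.2 Y.2⟩ ∈ negVal l}
  tensorR p l := OrderDual.toDual {Z | ∀ X ∈ posVal p, ⟨.pure, .bslash X.2 Z.2⟩ ∈ negVal l}
  oslashL l n := OrderDual.toDual {Z | ∀ D ∈ negVal n, ⟨.pure, .oplus Z.2 D.2⟩ ∈ negVal l}
  oslashR p r := OrderDual.toDual {Z | ∀ X ∈ posVal p, ⟨.pure, .obslash Z.2 X.2⟩ ∈ posVal r}
  obslashL r p := OrderDual.toDual {Z | ∀ X ∈ posVal p, ⟨.pure, .oslash X.2 Z.2⟩ ∈ posVal r}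
  obslashR m l := OrderDual.toDual {Z | ∀ G ∈ negVal m, ⟨.pure, .oplus G.2 Z.2⟩ ∈ negVal l}
  oplusL r n := {Z | ∀ D ∈ negVal n, ⟨.pure, .oslash Z.2 D.2⟩ ∈ posVal r}
  oplusR m r := {Z | ∀ G ∈ negVal m, ⟨.pure, .obslash G.2 Z.2⟩ ∈ posVal r}
  bslashL l n := {Z | ∀ D ∈ negVal n, ⟨.pure, .slash D.2 Z.2⟩ ∈ negVal l}
  bslashR p r := {Z | ∀ X ∈ posVal p, ⟨.pure, .tensor X.2 Z.2⟩ ∈ posVal r}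
  slashL r q := {Z | ∀ Y ∈ posVal q, ⟨.pure, .tensor Z.2 Y.2⟩ ∈ posVal r}
  slashR n l := {Z | ∀ D ∈ negVal n, ⟨.pure, .bslash Z.2 D.2⟩ ∈ negVal l}
  tensor_mono _ _ _ _ h k := Set.image2_subset (posVal_subset_of_leP h) (posVal_subset_of_leP k)
  oslash_mono _ _ _ _ h k := Set.image2_subset (posVal_subset_of_leP h) (negVal_subset_of_leN k)
  obslash_mono _ _ _ _ h k := Set.image2_subset (negVal_subset_of_leN h) (posVal_subset_of_leP k)
  oplus_mono _ _ _ _ h k := Set.image2_subset (negVal_subset_of_leN h) (negVal_subset_of_leN k)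
  bslash_mono _ _ _ _ h k := Set.image2_subset (posVal_subset_of_leP h) (negVal_subset_of_leN k)
  slash_mono _ _ _ _ h k := Set.image2_subset (negVal_subset_of_leN h) (posVal_subset_of_leP k)
  tensorL_mono _ _ _ _ h k _ hZ W hW := negVal_subset_of_leN h (hZ W (posVal_subset_of_leP k hW))
  tensorR_mono _ _ _ _ h k _ hZ W hW := negVal_subset_of_leN k (hZ W (posVal_subset_of_leP h hW))
  oslashL_mono _ _ _ _ h k _ hZ W hW := negVal_subset_of_leN h (hZ W (negVal_subset_of_leN k hW))
  oslashR_mono _ _ _ _ h k _ hZ W hW := posVal_subset_of_leP k (hZ W (posVal_subset_of_leP h hW))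
  obslashL_mono _ _ _ _ h k _ hZ W hW := posVal_subset_of_leP h (hZ W (posVal_subset_of_leP k hW))
  obslashR_mono _ _ _ _ h k _ hZ W hW := negVal_subset_of_leN k (hZ W (negVal_subset_of_leN h hW))
  oplusL_mono _ _ _ _ h k _ hZ W hW := posVal_subset_of_leP h (hZ W (negVal_subset_of_leN k hW))
  oplusR_mono _ _ _ _ h k _ hZ W hW := posVal_subset_of_leP k (hZ W (negVal_subset_of_leN h hW))
  bslashL_mono _ _ _ _ h k _ hZ W hW := negVal_subset_of_leN h (hZ W (negVal_subset_of_leN k hW))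
  bslashR_mono _ _ _ _ h k _ hZ W hW := posVal_subset_of_leP k (hZ W (posVal_subset_of_leP h hW))
  slashL_mono _ _ _ _ h k _ hZ W hW := posVal_subset_of_leP h (hZ W (posVal_subset_of_leP k hW))
  slashR_mono _ _ _ _ h k _ hZ W hW := negVal_subset_of_leN k (hZ W (negVal_subset_of_leN h hW))
  tensor_bslash _ _ _ := by
    refine turn_inP_iff.trans (Iff.trans ⟨fun h => ?_, fun h => ?_⟩ turn_inN_iff.symm)
    · rintro X hX _ ⟨Y, hY, Z, hZ, rfl⟩
      exact .tensor_bslash_bwd _ _ _ (h _ ⟨Y, hY, X, hX, rfl⟩ Z hZ)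
    · rintro _ ⟨X, hX, Y, hY, rfl⟩ Z hZ
      exact .tensor_bslash_fwd _ _ _ (h Y hY _ ⟨X, hX, Z, hZ, rfl⟩)
  tensor_slash _ _ _ := by
    refine turn_inP_iff.trans (Iff.trans ⟨fun h => ?_, fun h => ?_⟩ turn_inN_iff.symm)
    · rintro X hX _ ⟨Y, hY, Z, hZ, rfl⟩
      exact .tensor_slash_fwd _ _ _ (h _ ⟨X, hX, Z, hZ, rfl⟩ Y hY)
    · rintro _ ⟨X, hX, Y, hY, rfl⟩ Z hZ
      exact .tensor_slash_bwd _ _ _ (h X hX _ ⟨Z, hZ, Y, hY, rfl⟩)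
  oslash_oplus _ _ _ := by
    refine turn_inP_iff.trans (Iff.trans ⟨fun h => ?_, fun h => ?_⟩ turn_inN_iff.symm)
    · rintro X hX _ ⟨Y, hY, Z, hZ, rfl⟩
      exact .oslash_oplus_fwd _ _ _ (h _ ⟨X, hX, Z, hZ, rfl⟩ Y hY)
    · rintro _ ⟨X, hX, Y, hY, rfl⟩ Z hZ
      exact .oslash_oplus_bwd _ _ _ (h X hX _ ⟨Z, hZ, Y, hY, rfl⟩)
  obslash_oplus _ _ _ := by
    refine turn_inP_iff.trans (Iff.trans ⟨fun h => ?_, fun h => ?_⟩ turn_inN_iff.symm)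
    · rintro X hX _ ⟨Y, hY, Z, hZ, rfl⟩
      exact .obslash_oplus_bwd _ _ _ (h _ ⟨Y, hY, X, hX, rfl⟩ Z hZ)
    · rintro _ ⟨X, hX, Y, hY, rfl⟩ Z hZ
      exact .obslash_oplus_fwd _ _ _ (h Y hY _ ⟨X, hX, Z, hZ, rfl⟩)
  tensor_bslashR _ _ _ := leP_inP_iff.trans (Iff.trans
    ⟨fun h X hX Y hY => h _ ⟨Y, hY, X, hX, rfl⟩,
      by rintro h _ ⟨X, hX, Y, hY, rfl⟩; exact h Y hY X hX⟩
    leP_inSP_iff.symm)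
  tensor_slashL _ _ _ := leP_inP_iff.trans (Iff.trans
    ⟨fun h X hX Y hY => h _ ⟨X, hX, Y, hY, rfl⟩,
      by rintro h _ ⟨X, hX, Y, hY, rfl⟩; exact h X hX Y hY⟩
    leP_inSP_iff.symm)
  oslashL_oplus _ _ _ := leN_inSN_iff.trans (Iff.trans
    ⟨by rintro h _ ⟨X, hX, Y, hY, rfl⟩; exact h X hX Y hY,
      fun h X hX Y hY => h _ ⟨X, hX, Y, hY, rfl⟩⟩
    leN_inN_iff.symm)
  obslashR_oplus _ _ _ := leN_inSN_iff.trans (Iff.trans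
    ⟨by rintro h _ ⟨X, hX, Y, hY, rfl⟩; exact h Y hY X hX,
      fun h X hX Y hY => h _ ⟨Y, hY, X, hX, rfl⟩⟩
    leN_inN_iff.symm)
  tensorL_bslashL _ _ _ := leN_inSN_iff.trans
    (Iff.trans ⟨fun h X hX Y hY => h Y hY X hX, fun h X hX Y hY => h Y hY X hX⟩ leP_inSP_iff.symm)
  tensorL_slash _ _ _ := leN_inSN_iff.trans (Iff.trans
    ⟨by rintro h _ ⟨X, hX, Y, hY, rfl⟩; exact h X hX Y hY,
      fun h X hX Y hY => h _ ⟨X, hX, Y, hY, rfl⟩⟩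
    leN_inN_iff.symm)
  oslashR_oplusR _ _ _ := leN_inSN_iff.trans
    (Iff.trans ⟨fun h X hX Y hY => h Y hY X hX, fun h X hX Y hY => h Y hY X hX⟩ leP_inSP_iff.symm)
  obslash_oplusR _ _ _ := leP_inP_iff.trans (Iff.trans
    ⟨fun h X hX Y hY => h _ ⟨Y, hY, X, hX, rfl⟩,
      by rintro h _ ⟨X, hX, Y, hY, rfl⟩; exact h Y hY X hX⟩
    leP_inSP_iff.symm)
  tensorR_bslash _ _ _ := leN_inSN_iff.trans (Iff.trans
    ⟨by rintro h _ ⟨X, hX, Y, hY, rfl⟩; exact h Y hY X hX,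
      fun h X hX Y hY => h _ ⟨Y, hY, X, hX, rfl⟩⟩
    leN_inN_iff.symm)
  tensorR_slashR _ _ _ := leN_inSN_iff.trans
    (Iff.trans ⟨fun h X hX Y hY => h Y hY X hX, fun h X hX Y hY => h Y hY X hX⟩ leP_inSP_iff.symm)
  oslash_oplusL _ _ _ := leP_inP_iff.trans (Iff.trans
    ⟨fun h X hX Y hY => h _ ⟨X, hX, Y, hY, rfl⟩,
      by rintro h _ ⟨X, hX, Y, hY, rfl⟩; exact h X hX Y hY⟩
    leP_inSP_iff.symm)
  obslashL_oplusL _ _ _ := leN_inSN_iff.trans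
    (Iff.trans ⟨fun h X hX Y hY => h Y hY X hX, fun h X hX Y hY => h Y hY X hX⟩ leP_inSP_iff.symm)

/-! ### Formulas and their standard structures in neutral sequents -/

/-- In a neutral sequent, a positive formula `A` may replace the structure `A.std .plus` on the
left-hand side and a negative formula `A` the structure `A.std .minus` on the right-hand side. -/
def Fm.Folds : {p : Polarity} → {k : Kind} → Fm α β p k → Prop
  | .pos, _, A => ∀ ⦃j : Kind⦄ (D : Str α β .neg j),
      Derivable (A.std .plus ⊢⁰ D) → Derivable (.fm A ⊢⁰ D)
  | .neg, _, A => ∀ ⦃j : Kind⦄ (X : Str α β .pos j),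
      Derivable (X ⊢⁰ A.std .minus) → Derivable (X ⊢⁰ .fm A)

/-- The translation rules only apply to a connective whose arguments are formulas; display
postulates move each argument to its own side of the turnstile, where it is folded first. -/
theorem Fm.folds {p : Polarity} {k : Kind} (A : Fm α β p k) : A.Folds := by
  induction A with
  | posAtom a => exact fun _ _ h => h
  | negAtom b => exact fun _ _ h => h
  | down A _ => exact fun _ _ h => h
  | up A _ => exact fun _ _ h => h
  | tensor A B hA hB =>
    intro _ D h
    have h := hA _ (.tensor_slash_fwd _ _ _ h)
    have h := hB _ (.tensor_bslash_bwd _ _ _ (.tensor_slash_bwd _ _ _ h))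
    exact .tensor_left _ _ _ (.tensor_bslash_fwd _ _ _ h)
  | oslash A B hA hB =>
    intro _ D h
    have h := hA _ (.oslash_oplus_fwd _ _ _ h)
    have h := hB _ (.obslash_oplus_fwd _ _ _ h)
    exact .oslash_left _ _ _ (.oslash_oplus_bwd _ _ _ (.obslash_oplus_bwd _ _ _ h))
  | obslash A B hA hB =>
    intro _ D h
    have h := hB _ (.obslash_oplus_bwd _ _ _ h)
    have h := hA _ (.oslash_oplus_bwd _ _ _ h)
    exact .obslash_left _ _ _ (.obslash_oplus_fwd _ _ _ (.oslash_oplus_fwd _ _ _ h))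
  | oplus A B hA hB =>
    intro _ X h
    have h := hA _ (.oslash_oplus_bwd _ _ _ h)
    have h := hB _ (.obslash_oplus_fwd _ _ _ (.oslash_oplus_fwd _ _ _ h))
    exact .oplus_right _ _ _ (.obslash_oplus_bwd _ _ _ h)
  | bslash A B hA hB =>
    intro _ X h
    have h := hB _ (.tensor_bslash_fwd _ _ _ h)
    have h := hA _ (.tensor_slash_fwd _ _ _ h)
    exact .bslash_right _ _ _ (.tensor_bslash_bwd _ _ _ (.tensor_slash_bwd _ _ _ h))
  | slash A B hA hB =>
    intro _ X h
    have h := hA _ (.tensor_slash_bwd _ _ _ h)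
    have h := hB _ (.tensor_bslash_bwd _ _ _ h)
    exact .slash_right _ _ _ (.tensor_slash_fwd _ _ _ (.tensor_bslash_fwd _ _ _ h))

/-! ### Structures approximating the elements of the algebra of sets -/

/-- `Approximates s a X` says that the structure `X` bounds the element `a` on the side on which a
structure of sign `s` stands in a sequent: the left for `plus`, the right for `minus`. A positive
structure on the left and a negative one on the right have to be members of `a`. A positive
structure on the right has to be derivable from all the members of `a`, and a negative one on the
left has to derive all of them. -/
def Approximates : Sign → {p : Polarity} → {k : Kind} → (setAlgebra α β).Carrier p k →
    Str α β p k → Prop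
  | .plus, .pos, k, a, X => ⟨k, X⟩ ∈ posVal ((setAlgebra α β).toGP a)
  | .minus, .pos, _, a, X => ∀ Z ∈ posVal ((setAlgebra α β).toGP a), Derivable (Z.2 ⊢⁺ X)
  | .plus, .neg, _, n, D => ∀ G ∈ negVal ((setAlgebra α β).toGN n), Derivable (D ⊢⁻ G.2)
  | .minus, .neg, k, n, D => ⟨k, D⟩ ∈ negVal ((setAlgebra α β).toGN n)

theorem approximates_tensor {i j : Kind} {a : (setAlgebra α β).Carrier .pos i}
    {b : (setAlgebra α β).Carrier .pos j} {X : Str α β .pos i} {Y : Str α β .pos j}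
    (hX : Approximates .plus a X) (hY : Approximates .plus b Y) :
    Approximates .plus (p := .pos) (k := .pure)
      ((setAlgebra α β).tensor ((setAlgebra α β).toGP a) ((setAlgebra α β).toGP b))
      (.tensor X Y) :=
  ⟨_, ⟨_, hX, _, hY, rfl⟩, rfl⟩

theorem approximates_oslash {i j : Kind} {a : (setAlgebra α β).Carrier .pos i}
    {b : (setAlgebra α β).Carrier .neg j} {X : Str α β .pos i} {Y : Str α β .neg j}
    (hX : Approximates .plus a X) (hY : Approximates .minus b Y) :
    Approximates .plus (p := .pos) (k := .pure)
      ((setAlgebra α β).oslash ((setAlgebra α β).toGP a) ((setAlgebra α β).toGN b))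
      (.oslash X Y) :=
  ⟨_, ⟨_, hX, _, hY, rfl⟩, rfl⟩

theorem approximates_obslash {i j : Kind} {a : (setAlgebra α β).Carrier .neg i}
    {b : (setAlgebra α β).Carrier .pos j} {X : Str α β .neg i} {Y : Str α β .pos j}
    (hX : Approximates .minus a X) (hY : Approximates .plus b Y) :
    Approximates .plus (p := .pos) (k := .pure)
      ((setAlgebra α β).obslash ((setAlgebra α β).toGN a) ((setAlgebra α β).toGP b))
      (.obslash X Y) :=
  ⟨_, ⟨_, hX, _, hY, rfl⟩, rfl⟩

theorem approximates_oplus {i j : Kind} {a : (setAlgebra α β).Carrier .neg i}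
    {b : (setAlgebra α β).Carrier .neg j} {X : Str α β .neg i} {Y : Str α β .neg j}
    (hX : Approximates .minus a X) (hY : Approximates .minus b Y) :
    Approximates .minus (p := .neg) (k := .pure)
      ((setAlgebra α β).oplus ((setAlgebra α β).toGN a) ((setAlgebra α β).toGN b))
      (.oplus X Y) :=
  ⟨_, ⟨_, hX, _, hY, rfl⟩, rfl⟩

theorem approximates_bslash {i j : Kind} {a : (setAlgebra α β).Carrier .pos i}
    {b : (setAlgebra α β).Carrier .neg j} {X : Str α β .pos i} {Y : Str α β .neg j}
    (hX : Approximates .plus a X) (hY : Approximates .minus b Y) :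
    Approximates .minus (p := .neg) (k := .pure)
      ((setAlgebra α β).bslash ((setAlgebra α β).toGP a) ((setAlgebra α β).toGN b))
      (.bslash X Y) :=
  ⟨_, ⟨_, hX, _, hY, rfl⟩, rfl⟩

theorem approximates_slash {i j : Kind} {a : (setAlgebra α β).Carrier .neg i}
    {b : (setAlgebra α β).Carrier .pos j} {X : Str α β .neg i} {Y : Str α β .pos j}
    (hX : Approximates .minus a X) (hY : Approximates .plus b Y) :
    Approximates .minus (p := .neg) (k := .pure)
      ((setAlgebra α β).slash ((setAlgebra α β).toGN a) ((setAlgebra α β).toGP b))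
      (.slash X Y) :=
  ⟨_, ⟨_, hX, _, hY, rfl⟩, rfl⟩

theorem approximates_down {n : (setAlgebra α β).Carrier .neg .pure} {D : Str α β .neg .pure}
    (hD : Approximates .minus n D) :
    Approximates .minus (p := .pos) (k := .shifted) ((setAlgebra α β).down n) (.down D) :=
  fun _ hZ => .struct_down_fwd _ _ (hZ _ hD)

theorem approximates_up {a : (setAlgebra α β).Carrier .pos .pure} {X : Str α β .pos .pure}
    (hX : Approximates .plus a X) :
    Approximates .plus (p := .neg) (k := .shifted) ((setAlgebra α β).up a) (.up X) :=
  fun _ hG => .struct_up_fwd _ _ (hG _ hX)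

/-- The valuation sending each letter to its singleton. -/
def singletonValuation (α β : Type u) : Valuation α β (setAlgebra α β) where
  pos a := ({.fm (.posAtom a)} : Set (Str α β .pos .pure))
  neg b := OrderDual.toDual ({.fm (.negAtom b)} : Set (Str α β .neg .pure))

/-- The sign at which the binary connectives of the given polarity are PIA. The shifts `↓` and `↑`
are skeleton at this sign. -/
def Polarity.piaSign : Polarity → Sign
  | .pos => .minus
  | .neg => .plus

/-- A formula is approximated by its standard structures, and at the PIA sign of its polarity also
by itself. The two claims are proved together: a subformula kept operational in one of them may
contain a shift, under which the other one is needed. -/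
theorem Fm.approximates_std_and_fm {p : Polarity} {k : Kind} (A : Fm α β p k) :
    (∀ s : Sign, Approximates s (A.interp (singletonValuation α β)) (A.std s)) ∧
      Approximates p.piaSign (A.interp (singletonValuation α β)) (.fm A) := by
  induction A with
  | posAtom a =>
    have h : Approximates .minus ((Fm.posAtom a).interp (singletonValuation α β))
        (.fm (.posAtom a)) := by
      rintro _ ⟨_, rfl, rfl⟩
      exact .posId a
    refine ⟨fun s => ?_, h⟩
    cases s
    · exact ⟨_, rfl, rfl⟩
    · exact h
  | negAtom b =>
    have h : Approximates .plus ((Fm.negAtom b).interp (singletonValuation α β))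
        (.fm (.negAtom b)) := by
      rintro _ ⟨_, rfl, rfl⟩
      exact .negId b
    refine ⟨fun s => ?_, h⟩
    cases s
    · exact h
    · exact ⟨_, rfl, rfl⟩
  | tensor A B hA hB =>
    have h : Approximates .minus ((Fm.tensor A B).interp (singletonValuation α β))
        (.fm (.tensor A B)) := by
      rintro _ ⟨_, ⟨X, hX, Y, hY, rfl⟩, rfl⟩
      exact .tensor_right _ _ _ _ (hA.2 _ hX) (hB.2 _ hY)
    refine ⟨fun s => ?_, h⟩
    cases s
    · exact approximates_tensor (hA.1 .plus) (hB.1 .plus)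
    · exact h
  | oslash A B hA hB =>
    have h : Approximates .minus ((Fm.oslash A B).interp (singletonValuation α β))
        (.fm (.oslash A B)) := by
      rintro _ ⟨_, ⟨X, hX, Y, hY, rfl⟩, rfl⟩
      exact .oslash_right _ _ _ _ (hA.2 _ hX) (hB.2 _ hY)
    refine ⟨fun s => ?_, h⟩
    cases s
    · exact approximates_oslash (hA.1 .plus) (hB.1 .minus)
    · exact h
  | obslash A B hA hB =>
    have h : Approximates .minus ((Fm.obslash A B).interp (singletonValuation α β))
        (.fm (.obslash A B)) := by
      rintro _ ⟨_, ⟨X, hX, Y, hY, rfl⟩, rfl⟩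
      exact .obslash_right _ _ _ _ (hA.2 _ hX) (hB.2 _ hY)
    refine ⟨fun s => ?_, h⟩
    cases s
    · exact approximates_obslash (hA.1 .minus) (hB.1 .plus)
    · exact h
  | oplus A B hA hB =>
    have h : Approximates .plus ((Fm.oplus A B).interp (singletonValuation α β))
        (.fm (.oplus A B)) := by
      rintro _ ⟨_, ⟨X, hX, Y, hY, rfl⟩, rfl⟩
      exact .oplus_left _ _ _ _ (hA.2 _ hX) (hB.2 _ hY)
    refine ⟨fun s => ?_, h⟩
    cases s
    · exact h
    · exact approximates_oplus (hA.1 .minus) (hB.1 .minus)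
  | bslash A B hA hB =>
    have h : Approximates .plus ((Fm.bslash A B).interp (singletonValuation α β))
        (.fm (.bslash A B)) := by
      rintro _ ⟨_, ⟨X, hX, Y, hY, rfl⟩, rfl⟩
      exact .bslash_left _ _ _ _ (hA.2 _ hX) (hB.2 _ hY)
    refine ⟨fun s => ?_, h⟩
    cases s
    · exact h
    · exact approximates_bslash (hA.1 .plus) (hB.1 .minus)
  | slash A B hA hB =>
    have h : Approximates .plus ((Fm.slash A B).interp (singletonValuation α β))
        (.fm (.slash A B)) := by
      rintro _ ⟨_, ⟨X, hX, Y, hY, rfl⟩, rfl⟩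
      exact .slash_left _ _ _ _ (hA.2 _ hX) (hB.2 _ hY)
    refine ⟨fun s => ?_, h⟩
    cases s
    · exact h
    · exact approximates_slash (hA.1 .minus) (hB.1 .plus)
  | down A hA =>
    refine ⟨fun s => ?_, fun Z hZ => ?_⟩
    · cases s
      -- all members of the interpretation of `A` are pure, as the left rule for `↓` requires
      · rintro _ ⟨D, hD, rfl⟩
        exact .struct_down_bwd _ _ (.down_left _ _ (hA.2 _ ⟨D, hD, rfl⟩))
      · exact approximates_down (hA.1 .minus)
    · exact .down_right _ _ (.struct_down_fwd _ _ (A.folds _ (hZ _ (hA.1 .minus))))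
  | up A hA =>
    refine ⟨fun s => ?_, fun Z hZ => ?_⟩
    · cases s
      · exact approximates_up (hA.1 .plus)
      -- all members of the interpretation of `A` are pure, as the right rule for `↑` requires
      · rintro _ ⟨X, hX, rfl⟩
        exact .struct_up_bwd _ _ (.up_right _ _ (hA.2 _ ⟨X, hX, rfl⟩))
    · exact .up_left _ _ (.struct_up_fwd _ _ (A.folds _ (hZ _ (hA.1 .plus))))

theorem Str.interp_eq_of_form_eq_some {A : FPLGAlgebra.{u}} (v : Valuation α β A) {p : Polarity}
    {k : Kind} (X : Str α β p k) {B : Fm α β p k} (h : X.form = some B) :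
    X.interp v = B.interp v := by
  induction X <;>
    simp only [Str.form, Option.map₂_eq_some_iff, Option.map_eq_some_iff, Option.some.injEq,
      reduceCtorEq] at h
  case fm => rw [Str.interp, h]
  case down X ih | up X ih =>
    obtain ⟨B, hB, rfl⟩ := h
    rw [Str.interp, Fm.interp, ih hB]
  all_goals
    rename_i ihX ihY
    obtain ⟨B, C, hB, hC, rfl⟩ := h
    rw [Str.interp, Fm.interp, ihX hB, ihY hC]

/-- The case of a structure whose standard version is a formula, because its principal subtree is
PIA. -/
theorem approximates_of_form {p : Polarity} {k : Kind} {X X' : Str α β p k}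
    (h : X.form.map Str.fm = some X') :
    Approximates p.piaSign (X.interp (singletonValuation α β)) X' := by
  obtain ⟨A, hA, rfl⟩ := Option.map_eq_some_iff.1 h
  rw [X.interp_eq_of_form_eq_some _ hA]
  exact A.approximates_std_and_fm.2

/-! ### Completeness -/

/-- Every structure is approximated by its standard versions, where they exist. For a variant the
reason is residuation: its interpretation is a residual, and membership in it, tested against the
member provided by the standard version of an argument, is the display postulate. -/
theorem Str.approximates_std {p : Polarity} {k : Kind} (X : Str α β p k) (s : Sign)
    {X' : Str α β p k} (h : X.std s = some X') :
    Approximates s (X.interp (singletonValuation α β)) X' := by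
  induction X generalizing s with
  | fm A =>
    obtain rfl := Option.some.inj h
    exact A.approximates_std_and_fm.1 s
  | tensor X Y hX hY =>
    cases s
    · obtain ⟨X', Y', hX', hY', rfl⟩ := Option.map₂_eq_some_iff.1 h
      exact approximates_tensor (hX _ hX') (hY _ hY')
    · exact approximates_of_form h
  | oslash X Y hX hY =>
    cases s
    · obtain ⟨X', Y', hX', hY', rfl⟩ := Option.map₂_eq_some_iff.1 h
      exact approximates_oslash (hX _ hX') (hY _ hY')
    · exact approximates_of_form h
  | obslash X Y hX hY =>
    cases s
    · obtain ⟨X', Y', hX', hY', rfl⟩ := Option.map₂_eq_some_iff.1 h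
      exact approximates_obslash (hX _ hX') (hY _ hY')
    · exact approximates_of_form h
  | oplus X Y hX hY =>
    cases s
    · exact approximates_of_form h
    · obtain ⟨X', Y', hX', hY', rfl⟩ := Option.map₂_eq_some_iff.1 h
      exact approximates_oplus (hX _ hX') (hY _ hY')
  | bslash X Y hX hY =>
    cases s
    · exact approximates_of_form h
    · obtain ⟨X', Y', hX', hY', rfl⟩ := Option.map₂_eq_some_iff.1 h
      exact approximates_bslash (hX _ hX') (hY _ hY')
  | slash X Y hX hY =>
    cases s
    · exact approximates_of_form h
    · obtain ⟨X', Y', hX', hY', rfl⟩ := Option.map₂_eq_some_iff.1 h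
      exact approximates_slash (hX _ hX') (hY _ hY')
  | tensorL X Y hX hY =>
    cases s
    · obtain ⟨X', Y', hX', hY', rfl⟩ := Option.map₂_eq_some_iff.1 h
      exact fun G hG => .tensorL_slash_bwd _ _ _ (hX _ hX' _ (hG _ (hY _ hY')))
    · cases h
  | tensorR X Y hX hY =>
    cases s
    · obtain ⟨X', Y', hX', hY', rfl⟩ := Option.map₂_eq_some_iff.1 h
      exact fun G hG => .tensorR_bslash_fwd _ _ _ (hY _ hY' _ (hG _ (hX _ hX')))
    · cases h
  | oslashL X Y hX hY =>
    cases s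
    · obtain ⟨X', Y', hX', hY', rfl⟩ := Option.map₂_eq_some_iff.1 h
      exact fun G hG => .oslashL_oplus_bwd _ _ _ (hX _ hX' _ (hG _ (hY _ hY')))
    · cases h
  | oslashR X Y hX hY =>
    cases s
    · obtain ⟨X', Y', hX', hY', rfl⟩ := Option.map₂_eq_some_iff.1 h
      exact fun G hG => .oslashR_oplusR_fwd _ _ _
        (.obslash_oplusR_fwd _ _ _ (hY _ hY' _ (hG _ (hX _ hX'))))
    · cases h
  | obslashL X Y hX hY =>
    cases s
    · obtain ⟨X', Y', hX', hY', rfl⟩ := Option.map₂_eq_some_iff.1 h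
      exact fun G hG => .obslashL_oplusL_fwd _ _ _
        (.oslash_oplusL_fwd _ _ _ (hX _ hX' _ (hG _ (hY _ hY'))))
    · cases h
  | obslashR X Y hX hY =>
    cases s
    · obtain ⟨X', Y', hX', hY', rfl⟩ := Option.map₂_eq_some_iff.1 h
      exact fun G hG => .obslashR_oplus_fwd _ _ _ (hY _ hY' _ (hG _ (hX _ hX')))
    · cases h
  | oplusL X Y hX hY =>
    cases s
    · cases h
    · obtain ⟨X', Y', hX', hY', rfl⟩ := Option.map₂_eq_some_iff.1 h
      exact fun Z hZ => .oslash_oplusL_fwd _ _ _ (hX _ hX' _ (hZ _ (hY _ hY')))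
  | oplusR X Y hX hY =>
    cases s
    · cases h
    · obtain ⟨X', Y', hX', hY', rfl⟩ := Option.map₂_eq_some_iff.1 h
      exact fun Z hZ => .obslash_oplusR_fwd _ _ _ (hY _ hY' _ (hZ _ (hX _ hX')))
  | bslashL X Y hX hY =>
    cases s
    · cases h
    · obtain ⟨X', Y', hX', hY', rfl⟩ := Option.map₂_eq_some_iff.1 h
      exact fun Z hZ => .tensorL_bslashL_bwd _ _ _
        (.tensorL_slash_bwd _ _ _ (hX _ hX' _ (hZ _ (hY _ hY'))))
  | bslashR X Y hX hY =>
    cases s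
    · cases h
    · obtain ⟨X', Y', hX', hY', rfl⟩ := Option.map₂_eq_some_iff.1 h
      exact fun Z hZ => .tensor_bslashR_bwd _ _ _ (hY _ hY' _ (hZ _ (hX _ hX')))
  | slashL X Y hX hY =>
    cases s
    · cases h
    · obtain ⟨X', Y', hX', hY', rfl⟩ := Option.map₂_eq_some_iff.1 h
      exact fun Z hZ => .tensor_slashL_fwd _ _ _ (hX _ hX' _ (hZ _ (hY _ hY')))
  | slashR X Y hX hY =>
    cases s
    · cases h
    · obtain ⟨X', Y', hX', hY', rfl⟩ := Option.map₂_eq_some_iff.1 h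
      exact fun Z hZ => .tensorR_slashR_fwd _ _ _
        (.tensorR_bslash_fwd _ _ _ (hY _ hY' _ (hZ _ (hX _ hX'))))
  | down X hX =>
    cases s
    · obtain ⟨A, hA, rfl⟩ := Option.map_eq_some_iff.1 h
      rw [interp_eq_of_form_eq_some _ _ hA]
      cases A
      exact (Fm.down _).approximates_std_and_fm.1 .plus
    · obtain ⟨X', hX', rfl⟩ := Option.map_eq_some_iff.1 h
      exact approximates_down (hX _ hX')
  | downHarp X hX =>
    cases s
    · cases h
    · obtain ⟨X', hX', rfl⟩ := Option.map_eq_some_iff.1 h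
      rintro _ ⟨Z, hZ, rfl⟩
      exact .up_downHarp_fwd _ _ (.struct_up_fwd _ _ (hZ _ (hX _ hX')))
  | up X hX =>
    cases s
    · obtain ⟨X', hX', rfl⟩ := Option.map_eq_some_iff.1 h
      exact approximates_up (hX _ hX')
    · obtain ⟨A, hA, rfl⟩ := Option.map_eq_some_iff.1 h
      rw [interp_eq_of_form_eq_some _ _ hA]
      cases A
      exact (Fm.up _).approximates_std_and_fm.1 .minus
  | upHarp X hX =>
    cases s
    · obtain ⟨X', hX', rfl⟩ := Option.map_eq_some_iff.1 h
      rintro _ ⟨G, hG, rfl⟩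
      exact .upHarp_down_fwd _ _ (.struct_down_fwd _ _ (hG _ (hX _ hX')))
    · cases h

end FDLG

theorem mainTheorem1 (α β : Type u) (S S' : FDLG.Sequent α β)
    (hS' : S.standard = some S') (hvalid : S.Valid) : FDLG.Derivable S' := by
  have h := hvalid (FDLG.setAlgebra α β) (FDLG.singletonValuation α β)
  cases S with
  | pos X Y =>
    obtain ⟨X', Y', hX, hY, rfl⟩ := Option.map₂_eq_some_iff.1 hS'
    exact Y.approximates_std .minus hY _
      (FDLG.posVal_subset_of_leP h (X.approximates_std .plus hX))
  | neg X Y =>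
    obtain ⟨X', Y', hX, hY, rfl⟩ := Option.map₂_eq_some_iff.1 hS'
    exact X.approximates_std .plus hX _
      (FDLG.negVal_subset_of_leN h (Y.approximates_std .minus hY))
  | neutral X Y =>
    obtain ⟨X', Y', hX, hY, rfl⟩ := Option.map₂_eq_some_iff.1 hS'
    exact FDLG.derivable_of_turn h _ (X.approximates_std .plus hX) _
      (Y.approximates_std .minus hY)
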